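/- Let $S$ be a complete separable metric space with its Borel $\sigma$-algebra, and let $M_1=M_1(S)$ be the space of Borel probability measures on $S$ with the Prohorov metric (the topology of weak convergence). For a nonzero finite measure $\alpha$, let $\mathcal D(\alpha)$ be the law of a Dirichlet process with parameter $\alpha$, that is, of a random probability measure $\lambda$ such that $(\lambda(B_0),\dots,\lambda(B_d))$ has the Dirichlet distribution $\mathrm{Dir}(\alpha(B_0),\dots,\alpha(B_d))$ for every finite measurable partition $\{B_0,\dots,B_d\}$. Let $\kappa,\varepsilon\in(0,\infty)$ and $\varrho\in M_1$. Let $\xi=\{\xi_{ij}\}_{i,j\ge 1}$ be a row exchangeable array of $S$-valued random variables (its law is unchanged by permuting the rows and by permuting the entries within each row, the latter with a permutation that may depend on the row), with row distributions $\mu_1,\mu_2,\dots$ and row distribution generator $\varpi$: given $\varpi$, the $\mu_i$ are i.i.d. with distribution $\varpi$; for each $i$, given $\mu_i$, the $\xi_{i1},\xi_{i2},\dots$ are i.i.d. with distribution $\mu_i$. Assume that $\varpi\sim\mathcal D(\kappa\,\mathcal D(\varepsilon\varrho))$. Write $X_{mN}=(\xi_{m1},\dots,\xi_{mN})$ and let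 $\varrho_N$ be the law of $X_{mN}$, which does not depend on $m$. Let $M,N\in\mathbb N$, let $T$ be a countable set, let $\varphi_m:S^N\to T$ be measurable for $1\le m\le M$, and put $Y_m=\varphi_m(X_{mN})$ and $Y=(Y_1,\dots,Y_M)$. Fix $y\in T^M$ with $P(Y=y)>0$ and let $A_m=\varphi_m^{-1}(\{y_m\})$. A weighted simulation is a random vector $\mathbf u^*=(u_1^*,\dots,u_M^*)$ of elements of $M_1$ (the simulated row distributions) together with row weights $t_{mi}$, $1\le i\le m\le M$, given recursively by $t_{mi}=(u_i^*)^N(A_m)$ for $i<m$, $t_{mm}=\kappa\,\varrho_N(A_m)$, and $$\mathcal L(u_m^*\mid u_1^*,\dots,u_{m-1}^*)=\frac{1}{\sum_{i=1}^m t_{mi}}\left(t_{mm}\int_{S^N}\mathcal D\Big(\varepsilon\varrho+\sum_{n=1}^N\delta_{x_n}\Big)\,\varrho_N(dx\mid A_m)+\sum_{i=1}^{m-1}t_{mi}\,\delta_{u_i^*}\right).$$ Its total weight is $$V=\prod_{m=1}^M\frac1{\kappa+m-1}\sum_{i=1}^m t_{mi}.$$ Let $(t^k,\mathbf u^{*,k})$,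 $k=1,2,\dots$, be independent weighted simulations with total weights $V_k$. Then, almost surely, $$\mathcal L(\mu_1,\dots,\mu_M\mid Y=y)=\lim_{K\to\infty}\frac{\sum_{k=1}^K V_k\,\delta(\mathbf u^{*,k})}{\sum_{k=1}^K V_k}$$ in the sense of weak convergence of measures on $M_1^M$, where $\delta(z)$ is the point mass at $z$. Moreover, if $\Phi$ is a Borel measurable function on $M_1^M$ with values in a metric space, and $P((\mu_1,\dots,\mu_M)\in D^c\mid Y=y)=1$, where $D$ is the set of discontinuities of $\Phi$, then, almost surely, $$\mathcal L(\Phi(\mu_1,\dots,\mu_M)\mid Y=y)=\lim_{K\to\infty}\frac{\sum_{k=1}^K V_k\,\delta(\Phi(\mathbf u^{*,k}))}{\sum_{k=1}^K V_k}$$ in the sense of weak convergence. -/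

import Mathlib

open MeasureTheory ProbabilityTheory Filter Topology
open scoped NNReal ENNReal BoundedContinuousFunction

namespace NDP

/-- The Gamma distribution with shape `a` and rate `1`; for shape `0` it is the point mass at `0`. -/
noncomputable def gammaShape (a : ℝ) : Measure ℝ :=
  if 0 < a then gammaMeasure a 1 else Measure.dirac 0

/-- The Dirichlet distribution with parameters `a i ≥ 0`, not all zero: the law of
`(G i / ∑ j, G j)_i` for independent `G i` with Gamma distributions of shapes `a i` and rate `1`.
Coordinates with parameter `0` vanish. -/
noncomputable def dirichletDist {ι : Type*} [Fintype ι] (a : ι → ℝ) : Measure (ι → ℝ) :=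
  (Measure.pi fun i => gammaShape (a i)).map fun g i => g i / ∑ j, g j

/-- `Q` is the law of a Dirichlet process with parameter `α`, where `α` is a nonzero finite
measure: for every finite measurable partition `B 0, …, B d`, the vector `(λ(B 0), …, λ(B d))`
with `λ ∼ Q` has the Dirichlet distribution with parameters `α(B 0), …, α(B d)`. -/
structure IsDirichletLaw {E : Type*} [MeasurableSpace E] (α : Measure E)
    (Q : Measure (ProbabilityMeasure E)) : Prop where
  finite : IsFiniteMeasure α
  ne_zero : α ≠ 0
  fdd : ∀ (d : ℕ) (B : Fin (d + 1) → Set E), (∀ i, MeasurableSet (B i)) →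
    Pairwise (fun i j => Disjoint (B i) (B j)) → (⋃ i, B i) = Set.univ →
    Q.map (fun (ν : ProbabilityMeasure E) i => (ν : Measure E).real (B i))
      = dirichletDist fun i => α.real (B i)

open Classical in
/-- `𝒟(α)`, the law of a Dirichlet process with parameter `α`, a measure on the space of
probability measures. (The finite-dimensional distributions determine it uniquely, since the
measurable structure of `ProbabilityMeasure E` is generated by the evaluations `ν ↦ ν(B)`.) -/
noncomputable def dirichletLaw {E : Type*} [MeasurableSpace E] (α : Measure E) :
    Measure (ProbabilityMeasure E) :=
  if h : ∃ Q, IsDirichletLaw α Q then h.choose else 0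

/-- `Y ∣ X ∼ κ(X)` under `P`: the random variables `X`, `Y` are measurable, `κ` is a kernel, and
`κ` is a regular conditional distribution of `Y` given `X`. -/
structure HasCondLaw {Ω 𝓧 𝓨 : Type*} [MeasurableSpace Ω] [MeasurableSpace 𝓧] [MeasurableSpace 𝓨]
    (Y : Ω → 𝓨) (X : Ω → 𝓧) (κ : 𝓧 → Measure 𝓨) (P : Measure Ω) : Prop where
  measurable_left : Measurable Y
  measurable_right : Measurable X
  condDistrib : ∃ hκ : Measurable κ, HasCondDistrib Y X (⟨κ, hκ⟩ : Kernel 𝓧 𝓨) P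

/-- The law `ν^∞` of an i.i.d. sequence with distribution `ν`. -/
noncomputable def iidLaw {E : Type*} [MeasurableSpace E] (ν : ProbabilityMeasure E) :
    Measure (ℕ → E) :=
  Measure.infinitePi fun _ : ℕ => (ν : Measure E)

/-- Row exchangeability of a random array: permuting the rows, and permuting the entries within
each row (with a permutation that may depend on the row), does not change the law. -/
def RowExchangeable {Ω S : Type*} [MeasurableSpace Ω] [MeasurableSpace S]
    (ξ : ℕ → ℕ → Ω → S) (P : Measure Ω) : Prop :=
  ∀ (σ : Equiv.Perm ℕ) (τ : ℕ → Equiv.Perm ℕ),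
    IdentDistrib (fun ω (p : ℕ × ℕ) => ξ (σ p.1) (τ p.1 p.2) ω)
      (fun ω (p : ℕ × ℕ) => ξ p.1 p.2 ω) P P

/-- `ξ` is a row exchangeable array with row distributions `μ 0, μ 1, …` and row distribution
generator `ϖ`, where `ϖ` is a nested Dirichlet process, `ϖ ∼ 𝒟(κ 𝒟(ε ϱ))`. -/
structure IsNDPArray {Ω S : Type*} [MeasurableSpace Ω] [MeasurableSpace S]
    (κ ε : ℝ≥0) (ϱ : ProbabilityMeasure S)
    (ϖ : Ω → ProbabilityMeasure (ProbabilityMeasure S))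
    (μ : ℕ → Ω → ProbabilityMeasure S) (ξ : ℕ → ℕ → Ω → S) (P : Measure Ω) : Prop where
  rowExchangeable : RowExchangeable ξ P
  /-- Given `ϖ`, the row distributions are i.i.d. with distribution `ϖ`. -/
  rows : HasCondLaw (fun ω i => μ i ω) ϖ iidLaw P
  /-- Given `μ i`, the entries of row `i` are i.i.d. with distribution `μ i`. -/
  entries : ∀ i, HasCondLaw (fun ω j => ξ i j ω) (μ i) iidLaw P
  generator : HasLaw ϖ (dirichletLaw (κ • dirichletLaw (ε • (ϱ : Measure S)))) P

/-- The row data `X_{iN}`, the first `N` entries of row `i`. -/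
def rowData {Ω S : Type*} (ξ : ℕ → ℕ → Ω → S) (N i : ℕ) (ω : Ω) : Fin N → S :=
  fun j => ξ i j ω

section Simulation

variable {S : Type*} [MeasurableSpace S]

/-- The row weights `(t_{m,i})_i` of row number `m` (rows are counted from `0`), given the
simulated row distributions `v i` of the rows `i < m`. Here `A` is the event that encodes the
observation made on row `m`, and `ϱN` is the law of the first `N` entries of a row: the weights
are `(v i)^N(A)` for `i < m`, and `κ ϱN(A)` for `i = m`. -/
noncomputable def rowWeights {N : ℕ} (κ : ℝ≥0) (ϱN : Measure (Fin N → S)) (A : Set (Fin N → S))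
    {m : ℕ} (v : Fin m → ProbabilityMeasure S) : Fin (m + 1) → ℝ≥0 :=
  Fin.snoc (α := fun _ => ℝ≥0)
    (fun i : Fin m => ProbabilityMeasure.pi (fun _ : Fin N => v i) A) (κ * (ϱN A).toNNReal)

/-- The mixture `∫ 𝒟(ε ϱ + ∑ n, δ_{x n}) ϱN(dx ∣ A)` of Dirichlet laws. -/
noncomputable def freshLaw {N : ℕ} (ε : ℝ≥0) (ϱ : ProbabilityMeasure S)
    (ϱN : Measure (Fin N → S)) (A : Set (Fin N → S)) : Measure (ProbabilityMeasure S) :=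
  (ProbabilityTheory.cond ϱN A).bind fun x =>
    dirichletLaw (ε • (ϱ : Measure S) + ∑ n, Measure.dirac (x n))

/-- The law of the next simulated row distribution, given the earlier ones `v`: the normalization
of `t_m ∫ 𝒟(ε ϱ + ∑ n, δ_{x n}) ϱN(dx ∣ A) + ∑ i < m, t_i δ_{v i}`, with `t` the row weights. -/
noncomputable def stepLaw {N : ℕ} (κ ε : ℝ≥0) (ϱ : ProbabilityMeasure S)
    (ϱN : Measure (Fin N → S)) (A : Set (Fin N → S)) {m : ℕ}
    (v : Fin m → ProbabilityMeasure S) : Measure (ProbabilityMeasure S) :=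
  (∑ i, rowWeights κ ϱN A v i)⁻¹ •
    (rowWeights κ ϱN A v (Fin.last m) • freshLaw ε ϱ ϱN A
      + ∑ i : Fin m, rowWeights κ ϱN A v i.castSucc • Measure.dirac (v i))

/-- The first `m` entries of a vector of length `M`. -/
def before {M : ℕ} {E : Type*} (u : Fin M → E) (m : Fin M) : Fin m → E :=
  fun i => u (Fin.castLE m.2.le i)

/-- The random vector `u` consists of the simulated row distributions of a weighted simulation:
for each row `m`, the conditional law of `u m` given the earlier ones is `stepLaw`. The row
weights are the functions `rowWeights` of `u`. -/
def IsSimulation {Ω' : Type*} [MeasurableSpace Ω'] {M N : ℕ} (κ ε : ℝ≥0)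
    (ϱ : ProbabilityMeasure S) (ϱN : Measure (Fin N → S)) (A : Fin M → Set (Fin N → S))
    (u : Ω' → Fin M → ProbabilityMeasure S) (P' : Measure Ω') : Prop :=
  ∀ m : Fin M, HasCondLaw (fun ω => u ω m) (fun ω => before (u ω) m)
    (stepLaw κ ε ϱ ϱN (A m)) P'

/-- The total weight `V = ∏ m, (κ + m)⁻¹ ∑ i ≤ m, t_{m,i}` of a weighted simulation (the index `m`
starts at `0`). -/
noncomputable def totalWeight {M N : ℕ} (κ : ℝ≥0) (ϱN : Measure (Fin N → S))
    (A : Fin M → Set (Fin N → S)) (u : Fin M → ProbabilityMeasure S) : ℝ≥0 :=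
  ∏ m : Fin M, (κ + (m : ℕ))⁻¹ * ∑ i, rowWeights κ ϱN (A m) (before u m) i

end Simulation

/-- The weighted empirical measure `(∑ k < K, V k δ(z k)) / (∑ k < K, V k)`. -/
noncomputable def weightedEmpirical {E : Type*} [MeasurableSpace E] (V : ℕ → ℝ≥0) (z : ℕ → E)
    (K : ℕ) : Measure E :=
  (∑ k ∈ Finset.range K, V k)⁻¹ • ∑ k ∈ Finset.range K, V k • Measure.dirac (z k)

/-- Weak convergence of a sequence of measures, tested on bounded continuous functions. -/
def WeaklyTendsto {E : Type*} [TopologicalSpace E] [MeasurableSpace E] (Q : ℕ → Measure E)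
    (Qlim : Measure E) : Prop :=
  ∀ f : E →ᵇ ℝ, Tendsto (fun K => ∫ x, f x ∂(Q K)) atTop (𝓝 (∫ x, f x ∂Qlim))

end NDP

/-! The statement is self-normalised importance sampling. Put β = κ𝒟(εϱ), and let Λ be the law of M
draws from a random measure with law 𝒟(β), which is `sampleLaw` of 𝒟(β). Both E[g(μ); Y = y] and E[V
g(u*)] equal the integral of g(v) ∏ v_m^N(A_m) against Λ. The strong law for V_k 1_B(u_k) and for
V_k then makes the weighted empirical mass of B converge to P(μ ∈ B | Y = y).

Simulation side (`IsSimulation.lintegral_totalWeight_mul`). Under Λ, the next draw given earlier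
draws v has the Pólya urn law, proportional to β + ∑ δ_{v i}. Reweight it by z^N(A). On the atoms
this gives the weights v_i^N(A). On the continuous part, conjugacy turns z^N(A) 𝒟(εϱ)(dz) into
ϱ_N(A) times the mixture of posteriors over ϱ_N(· | A). So the reweighted urn is the step law times
the sum of the row weights (`lintegral_stepLaw`), and the product of these sums over the urn
constants κ + m is V.

Conjugacy and the urn come from two facts on Gamma variables. Exponential tilting only rescales, so
the sum of independent Gammas is independent of their ratios. Weighting by x raises the shape by
one, so weighting a Dirichlet vector by coordinate j raises parameter j by one. The second fact,
read on finite partitions, is the one-observation rule `lintegral_dirichletLaw_one`, and induction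
on the sample size does the rest.

Array side (`IsNDPArray.lintegral_obs`). The hypotheses describe each row given its own μ_i only.
Joint independence of the rows given all μ_i is derived from row exchangeability: the observed block
of each row may be replaced by any other block of that row, so its indicator may be replaced by a
long-run block frequency, which converges to μ_m^N(A_m).

Limit side. Convergence on the countably many finite unions of basic open sets holds off one null
set and implies the portmanteau inequality for all open sets, hence convergence for every bounded,
almost everywhere continuous test function. This requires the weak topology on probability measures
to be second countable with opens measurable for the evaluation σ-algebra. -/

namespace NDP

/-! ### Densities and scalars in finite products -/

section Pi

variable {ι : Type*} [Fintype ι] {X : ι → Type*} [∀ i, MeasurableSpace (X i)]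

theorem pi_withDensity (μ : ∀ i, Measure (X i)) [∀ i, IsProbabilityMeasure (μ i)]
    (f : ∀ i, X i → ℝ≥0∞) (hf : ∀ i, Measurable (f i))
    [∀ i, SigmaFinite ((μ i).withDensity (f i))] :
    (Measure.pi μ).withDensity (fun x => ∏ i, f i (x i))
      = Measure.pi fun i => (μ i).withDensity (f i) := by
  classical
  refine (Measure.pi_eq fun s hs => ?_).symm
  rw [withDensity_apply _ (MeasurableSet.univ_pi hs), ← lintegral_indicator (MeasurableSet.univ_pi hs)]
  have h1 : ∀ x : ∀ i, X i, (Set.univ.pi s).indicator (fun x => ∏ i, f i (x i)) x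
      = ∏ i, (s i).indicator (f i) (x i) := by
    intro x
    by_cases hx : x ∈ Set.univ.pi s
    · rw [Set.indicator_of_mem hx]
      exact Finset.prod_congr rfl fun i _ => by
        rw [Set.indicator_of_mem (hx i (Set.mem_univ i))]
    · rw [Set.indicator_of_notMem hx]
      have : ∃ i, x i ∉ s i := by simpa [Set.mem_pi] using hx
      obtain ⟨i, hi⟩ := this
      exact (Finset.prod_eq_zero (Finset.mem_univ i) (Set.indicator_of_notMem hi _)).symm
  simp_rw [h1]
  have h2 : iIndepFun (fun i (x : ∀ i, X i) => (s i).indicator (f i) (x i)) (Measure.pi μ) :=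
    iIndepFun_pi (X := fun i => (s i).indicator (f i))
      fun i => ((hf i).indicator (hs i)).aemeasurable
  rw [lintegral_prod_eq_prod_lintegral_of_indepFun Finset.univ _ h2
    fun i => ((hf i).indicator (hs i)).comp (measurable_pi_apply i)]
  refine Finset.prod_congr rfl fun i _ => ?_
  rw [withDensity_apply _ (hs i), ← lintegral_indicator (hs i)]
  exact (measurePreserving_eval μ i).lintegral_comp ((hf i).indicator (hs i))

theorem pi_smul_measure (μ : ∀ i, Measure (X i)) [∀ i, IsFiniteMeasure (μ i)] (c : ι → ℝ≥0∞)
    (hc : ∀ i, c i ≠ ∞) :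
    Measure.pi (fun i => c i • μ i) = (∏ i, c i) • Measure.pi μ := by
  have := fun i => (μ i).smul_finite (hc i)
  refine Measure.pi_eq fun s hs => ?_
  simp [Measure.pi_pi, Finset.prod_mul_distrib]

end Pi

/-! ### Gamma distributions: tilting and size biasing -/

section Gamma

theorem measurable_gammaPDF (a r : ℝ) : Measurable (gammaPDF a r) :=
  (measurable_gammaPDFReal a r).ennreal_ofReal

theorem isProbabilityMeasure_gammaShape (a : ℝ) : IsProbabilityMeasure (gammaShape a) := by
  unfold gammaShape
  split_ifs with h
  · exact isProbabilityMeasure_gammaMeasure h one_pos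
  · infer_instance

attribute [instance] isProbabilityMeasure_gammaShape

theorem gammaShape_zero : gammaShape 0 = Measure.dirac 0 := by simp [gammaShape]

theorem ae_nonneg_gammaShape (a : ℝ) : ∀ᵐ x ∂gammaShape a, 0 ≤ x := by
  unfold gammaShape
  split_ifs with h
  · rw [gammaMeasure, ae_withDensity_iff (measurable_gammaPDF a 1)]
    refine ae_of_all _ fun x hx => ?_
    by_contra hneg
    exact hx (gammaPDF_of_neg (not_le.1 hneg))
  · simp [ae_dirac_eq]

theorem ae_ne_zero_gammaShape {a : ℝ} (ha : 0 < a) : ∀ᵐ x ∂gammaShape a, x ≠ 0 := by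
  rw [gammaShape, if_pos ha, gammaMeasure]
  refine (withDensity_absolutelyContinuous _ _).ae_le ?_
  exact Measure.ae_ne volume 0

theorem gammaMeasure_eq_map {a r : ℝ} (hr : 0 < r) :
    gammaMeasure a r = (gammaMeasure a 1).map fun x => x / r := by
  have hm : Measurable fun x : ℝ => x / r := by fun_prop
  ext s hs
  rw [Measure.map_apply hm hs, gammaMeasure, gammaMeasure, withDensity_apply _ hs,
    withDensity_apply _ (hm hs), ← lintegral_indicator hs, ← lintegral_indicator (hm hs)]
  let G : ℝ → ℝ≥0∞ := fun y => s.indicator (fun y => gammaPDF a 1 (r * y)) y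
  have hG : Measurable G :=
    Measurable.indicator ((measurable_gammaPDF a 1).comp
      (measurable_const_mul r)) hs
  have h1 : ∀ x, ((fun x : ℝ => x / r) ⁻¹' s).indicator (fun x => gammaPDF a 1 x) x
      = G (r⁻¹ * x) := by
    intro x
    by_cases hx : x / r ∈ s
    · rw [Set.indicator_of_mem (by exact hx)]
      simp only [G]
      rw [Set.indicator_of_mem (by rwa [inv_mul_eq_div])]
      congr 1
      field_simp
    · rw [Set.indicator_of_notMem (by exact hx)]
      simp only [G]
      rw [Set.indicator_of_notMem (by rwa [inv_mul_eq_div])]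
  simp_rw [h1]
  rw [← lintegral_map hG (measurable_const_mul r⁻¹),
    Real.map_volume_mul_left (inv_ne_zero hr.ne'), lintegral_smul_measure, inv_inv, abs_of_pos hr,
    smul_eq_mul, ← lintegral_const_mul _ hG]
  refine lintegral_congr fun y => ?_
  by_cases hy : y ∈ s
  · simp only [G, Set.indicator_of_mem hy, gammaPDF, gammaPDFReal]
    rw [← ENNReal.ofReal_mul hr.le]
    congr 1
    by_cases h0 : 0 ≤ y
    · rw [if_pos h0, if_pos (by positivity), Real.one_rpow, Real.mul_rpow hr.le h0,
        Real.rpow_sub_one hr.ne']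
      field_simp
    · rw [if_neg h0, if_neg (by nlinarith), mul_zero]
  · simp [G, hy]

/-- Tilting adds t to the rate, and a change of rate is a change of scale. The point mass convention
at shape 0 obeys the same rule, so vanishing parameters need no separate treatment later. -/
theorem gammaShape_withDensity_exp {a t : ℝ} (ha : 0 ≤ a) (ht : 0 ≤ t) :
    (gammaShape a).withDensity (fun x => ENNReal.ofReal (Real.exp (-(t * x))))
      = ENNReal.ofReal ((1 + t) ^ (-a)) • (gammaShape a).map fun x => x / (1 + t) := by
  have hr : 0 < 1 + t := by linarith
  have he : Measurable fun x : ℝ => ENNReal.ofReal (Real.exp (-(t * x))) := by fun_prop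
  rcases ha.eq_or_lt with rfl | h
  · rw [gammaShape_zero, Measure.map_dirac' (by fun_prop)]
    ext s hs
    rw [withDensity_apply _ hs, ← lintegral_indicator hs, lintegral_dirac' _ (he.indicator hs)]
    by_cases h0 : (0 : ℝ) ∈ s <;> simp [h0, hs]
  · rw [gammaShape, if_pos h, ← gammaMeasure_eq_map hr, gammaMeasure, gammaMeasure,
      ← withDensity_mul _ (measurable_gammaPDF a 1) he,
      ← withDensity_smul _ (measurable_gammaPDF _ _)]
    congr 1
    ext x
    simp only [Pi.mul_apply, Pi.smul_apply, smul_eq_mul, gammaPDF, gammaPDFReal]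
    rw [← ENNReal.ofReal_mul' (Real.exp_pos _).le, ← ENNReal.ofReal_mul (by positivity)]
    congr 1
    split_ifs with h0
    · rw [Real.one_rpow, Real.rpow_neg hr.le, one_mul, add_mul, one_mul, neg_add, Real.exp_add]
      field_simp
    · simp

/-- Size biasing: the extra factor x raises the exponent in the density, and Γ(a + 1) = aΓ(a)
supplies the constant. At shape 0 both sides vanish. -/
theorem gammaShape_withDensity_id {a : ℝ} (ha : 0 ≤ a) :
    (gammaShape a).withDensity (fun x => ENNReal.ofReal x)
      = ENNReal.ofReal a • gammaShape (a + 1) := by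
  rcases ha.eq_or_lt with rfl | h
  · rw [gammaShape_zero]
    ext s hs
    rw [withDensity_apply _ hs, ← lintegral_indicator hs,
      lintegral_dirac' _ (ENNReal.measurable_ofReal.indicator hs)]
    by_cases h0 : (0 : ℝ) ∈ s <;> simp [h0]
  · rw [gammaShape, gammaShape, if_pos h, if_pos (by linarith), gammaMeasure, gammaMeasure,
      ← withDensity_mul _ (measurable_gammaPDF a 1) ENNReal.measurable_ofReal,
      ← withDensity_smul _ (measurable_gammaPDF _ _)]
    congr 1
    ext x
    simp only [Pi.mul_apply, Pi.smul_apply, smul_eq_mul, gammaPDF, gammaPDFReal]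
    by_cases h0 : 0 ≤ x
    · rw [← ENNReal.ofReal_mul' h0, ← ENNReal.ofReal_mul h.le]
      congr 1
      rw [if_pos h0, if_pos h0, Real.Gamma_add_one h.ne', add_sub_cancel_right]
      have hG := (Real.Gamma_pos_of_pos h).ne'
      rcases h0.eq_or_lt with rfl | hx
      · simp [Real.zero_rpow h.ne']
      · rw [Real.rpow_sub_one hx.ne', Real.one_rpow, Real.one_rpow]
        field_simp
    · simp [h0]

theorem lintegral_ofReal_gammaShape {a : ℝ} (ha : 0 ≤ a) :
    ∫⁻ x, ENNReal.ofReal x ∂gammaShape a = ENNReal.ofReal a := by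
  have := congrArg (fun m => m Set.univ) (gammaShape_withDensity_id ha)
  simpa [withDensity_apply] using this

theorem lintegral_exp_gammaShape {a t : ℝ} (ha : 0 ≤ a) (ht : 0 ≤ t) :
    ∫⁻ x, ENNReal.ofReal (Real.exp (-(t * x))) ∂gammaShape a
      = ENNReal.ofReal ((1 + t) ^ (-a)) := by
  have := congrArg (fun m => m Set.univ) (gammaShape_withDensity_exp ha ht)
  simpa [withDensity_apply, Measure.map_apply (show Measurable fun x : ℝ => x / (1 + t) by fun_prop)]
    using this

end Gamma

/-! ### Uniqueness of Laplace transforms at the integers -/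

section Laplace

/-- The function `x ↦ exp (-x)` on the nonnegative reals. -/
noncomputable def expNegBCF : ℝ≥0 →ᵇ ℝ :=
  BoundedContinuousFunction.ofNormedAddCommGroup (fun x : ℝ≥0 => Real.exp (-(x : ℝ)))
    (by fun_prop) 1 fun x => by
      rw [Real.norm_eq_abs, abs_of_pos (Real.exp_pos _), Real.exp_le_one_iff]
      simp

theorem expNegBCF_pow_apply (n : ℕ) (x : ℝ≥0) :
    (expNegBCF ^ n) x = Real.exp (-(n * (x : ℝ))) := by
  rw [BoundedContinuousFunction.coe_pow, Pi.pow_apply]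
  change Real.exp (-(x : ℝ)) ^ n = _
  rw [← Real.exp_nat_mul]
  ring_nf

/-- The star subalgebra generated by `x ↦ exp (-x)`. -/
noncomputable def expNegAlgebra : StarSubalgebra ℝ (ℝ≥0 →ᵇ ℝ) where
  toSubalgebra := Algebra.adjoin ℝ {expNegBCF}
  star_mem' {f} hf := by
    have : star f = f := by ext x; simp
    rwa [this]

/-- Powers of exp(-x) span an algebra of bounded continuous functions that separates points, so
integer arguments suffice. The argument n = 0 accounts for the constants. -/
theorem measure_nnreal_ext_of_laplace {μ ν : Measure ℝ≥0} [IsFiniteMeasure μ] [IsFiniteMeasure ν]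
    (h : ∀ n : ℕ, ∫ x, Real.exp (-(n * (x : ℝ))) ∂μ = ∫ x, Real.exp (-(n * (x : ℝ))) ∂ν) :
    μ = ν := by
  refine ext_of_forall_mem_subalgebra_integral_eq_of_polish (𝕜 := ℝ) (A := expNegAlgebra) ?_ ?_
  · intro x y hxy
    refine ⟨expNegBCF, ⟨BoundedContinuousFunction.toContinuousMapStarₐ ℝ expNegBCF,
      ⟨expNegBCF, Algebra.subset_adjoin rfl, rfl⟩, rfl⟩, ?_⟩
    change Real.exp (-(x : ℝ)) ≠ Real.exp (-(y : ℝ))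
    simpa using hxy
  · intro g hg
    have hg' : g ∈ Subalgebra.toSubmodule (Algebra.adjoin ℝ {expNegBCF}) := hg
    rw [Algebra.adjoin_eq_span] at hg'
    clear hg
    induction hg' using Submodule.span_induction with
    | mem g hg =>
      obtain ⟨n, rfl⟩ := Submonoid.mem_closure_singleton.1 hg
      simpa only [expNegBCF_pow_apply] using h n
    | zero => simp
    | add f g hf hg ihf ihg =>
      simp only [BoundedContinuousFunction.coe_add, Pi.add_apply]
      rw [integral_add (f.integrable _) (g.integrable _),
        integral_add (f.integrable _) (g.integrable _), ihf, ihg]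
    | smul c f hf ihf =>
      simp only [BoundedContinuousFunction.coe_smul]
      rw [integral_smul, integral_smul, ihf]

theorem measure_ext_of_laplace {μ ν : Measure ℝ} [IsFiniteMeasure μ] [IsFiniteMeasure ν]
    (hμ : ∀ᵐ x ∂μ, 0 ≤ x) (hν : ∀ᵐ x ∂ν, 0 ≤ x)
    (h : ∀ n : ℕ, ∫⁻ x, ENNReal.ofReal (Real.exp (-(n * x))) ∂μ
      = ∫⁻ x, ENNReal.ofReal (Real.exp (-(n * x))) ∂ν) :
    μ = ν := by
  have key : ∀ ρ : Measure ℝ, (∀ᵐ x ∂ρ, 0 ≤ x) →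
      (ρ.map Real.toNNReal).map (fun x : ℝ≥0 => (x : ℝ)) = ρ := by
    intro ρ hρ
    rw [Measure.map_map (by fun_prop) (by fun_prop)]
    conv_rhs => rw [← Measure.map_id (μ := ρ)]
    refine Measure.map_congr ?_
    filter_upwards [hρ] with x hx
    simp [hx]
  have key2 : ∀ ρ : Measure ℝ, (∀ᵐ x ∂ρ, 0 ≤ x) → ∀ n : ℕ,
      ∫ x, Real.exp (-(n * (x : ℝ))) ∂(ρ.map Real.toNNReal)
        = (∫⁻ x, ENNReal.ofReal (Real.exp (-(n * x))) ∂ρ).toReal := by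
    intro ρ hρ n
    rw [integral_map (by fun_prop) (by fun_prop), integral_eq_lintegral_of_nonneg_ae
      (ae_of_all _ fun x => (Real.exp_pos _).le) (by fun_prop)]
    congr 1
    refine lintegral_congr_ae ?_
    filter_upwards [hρ] with x hx
    simp [hx]
  rw [← key μ hμ, ← key ν hν]
  congr 1
  refine measure_nnreal_ext_of_laplace fun n => ?_
  rw [key2 μ hμ, key2 ν hν, h]

end Laplace

/-! ### Finite-dimensional Dirichlet distributions -/

section Dirichlet

theorem gammaShape_conv {a b : ℝ} (ha : 0 ≤ a) (hb : 0 ≤ b) :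
    ((gammaShape a).prod (gammaShape b)).map (fun p => p.1 + p.2) = gammaShape (a + b) := by
  have hm : Measurable fun p : ℝ × ℝ => p.1 + p.2 := by fun_prop
  have := Measure.isProbabilityMeasure_map (μ := (gammaShape a).prod (gammaShape b))
    hm.aemeasurable
  refine measure_ext_of_laplace ?_ (ae_nonneg_gammaShape _) fun n => ?_
  · rw [ae_map_iff hm.aemeasurable measurableSet_Ici]
    filter_upwards [Measure.quasiMeasurePreserving_fst.ae (ae_nonneg_gammaShape a),
      Measure.quasiMeasurePreserving_snd.ae (ae_nonneg_gammaShape b)] with p h1 h2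
    exact add_nonneg h1 h2
  · rw [lintegral_map (by fun_prop) hm, lintegral_exp_gammaShape (add_nonneg ha hb) (by positivity)]
    have : ∀ p : ℝ × ℝ, ENNReal.ofReal (Real.exp (-(n * (p.1 + p.2))))
        = ENNReal.ofReal (Real.exp (-(n * p.1))) * ENNReal.ofReal (Real.exp (-(n * p.2))) := by
      intro p
      rw [← ENNReal.ofReal_mul (Real.exp_pos _).le, ← Real.exp_add]
      ring_nf
    simp_rw [this]
    have hn : Measurable fun x : ℝ => ENNReal.ofReal (Real.exp (-(n * x))) := by fun_prop
    rw [lintegral_prod_mul hn.aemeasurable hn.aemeasurable, lintegral_exp_gammaShape ha (by positivity),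
      lintegral_exp_gammaShape hb (by positivity), ← ENNReal.ofReal_mul (by positivity),
      neg_add, Real.rpow_add (by positivity)]

variable {ι : Type*} [Fintype ι]

theorem ae_nonneg_pi_gammaShape (a : ι → ℝ) :
    ∀ᵐ g ∂(Measure.pi fun i => gammaShape (a i)), ∀ i, 0 ≤ g i :=
  ae_all_iff.2 fun i =>
    (measurePreserving_eval (fun i => gammaShape (a i)) i).quasiMeasurePreserving.ae
      (ae_nonneg_gammaShape (a i))

/-- Normalization of a vector by its sum. -/
noncomputable def ratio (g : ι → ℝ) : ι → ℝ := fun i => g i / ∑ j, g j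

theorem measurable_ratio : Measurable (ratio : (ι → ℝ) → ι → ℝ) := by
  unfold ratio; fun_prop

theorem dirichletDist_eq (a : ι → ℝ) :
    dirichletDist a = (Measure.pi fun i => gammaShape (a i)).map ratio := rfl

theorem isProbabilityMeasure_dirichletDist (a : ι → ℝ) :
    IsProbabilityMeasure (dirichletDist a) :=
  Measure.isProbabilityMeasure_map measurable_ratio.aemeasurable

attribute [instance] isProbabilityMeasure_dirichletDist

theorem ratio_div (g : ι → ℝ) {r : ℝ} (hr : r ≠ 0) : ratio (fun i => g i / r) = ratio g := by
  ext i
  simp only [ratio, ← Finset.sum_div]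
  exact div_div_div_cancel_right₀ hr _ _

theorem pi_gammaShape_withDensity_exp {a : ι → ℝ} (ha : ∀ i, 0 ≤ a i) {t : ℝ} (ht : 0 ≤ t) :
    (Measure.pi fun i => gammaShape (a i)).withDensity
        (fun g => ENNReal.ofReal (Real.exp (-(t * ∑ i, g i))))
      = ENNReal.ofReal ((1 + t) ^ (-∑ i, a i)) •
        (Measure.pi fun i => gammaShape (a i)).map fun g i => g i / (1 + t) := by
  have h1 : (fun g : ι → ℝ => ENNReal.ofReal (Real.exp (-(t * ∑ i, g i))))
      = fun g => ∏ i, ENNReal.ofReal (Real.exp (-(t * g i))) := by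
    ext g
    rw [← ENNReal.ofReal_prod_of_nonneg fun i _ => (Real.exp_pos _).le, ← Real.exp_sum,
      Finset.mul_sum, Finset.sum_neg_distrib]
  have h2 := fun i => gammaShape_withDensity_exp (ha i) ht
  have hm : Measurable fun x : ℝ => x / (1 + t) := by fun_prop
  have hp := fun i => Measure.isProbabilityMeasure_map (μ := gammaShape (a i)) hm.aemeasurable
  have : ∀ i, IsFiniteMeasure ((gammaShape (a i)).withDensity
      fun x => ENNReal.ofReal (Real.exp (-(t * x)))) := fun i => by
    rw [h2 i]; exact Measure.smul_finite _ ENNReal.ofReal_ne_top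
  rw [h1, pi_withDensity (fun i => gammaShape (a i))
    (fun _ x => ENNReal.ofReal (Real.exp (-(t * x)))) (fun i => by fun_prop)]
  simp_rw [h2]
  rw [pi_smul_measure (fun i => (gammaShape (a i)).map fun x => x / (1 + t)) _
      fun i => ENNReal.ofReal_ne_top, Measure.pi_map_pi (fun i => hm.aemeasurable),
    ← ENNReal.ofReal_prod_of_nonneg fun i _ => by positivity, ← Finset.sum_neg_distrib,
    Real.rpow_sum_of_pos (by positivity)]

/-- Tilting the product measure by exp(-t ∑ g) multiplies it by a constant and rescales all
coordinates, while the ratios are invariant under scaling. Hence, restricted to any event about the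
ratios, the sum has the Laplace transform of a Gamma variable times the probability of that event.
-/
theorem pi_gammaShape_map_sum_ratio {a : ι → ℝ} (ha : ∀ i, 0 ≤ a i) :
    (Measure.pi fun i => gammaShape (a i)).map (fun g => (∑ i, g i, ratio g))
      = (gammaShape (∑ i, a i)).prod (dirichletDist a) := by
  have hs : Measurable fun g : ι → ℝ => ∑ i, g i := by fun_prop
  refine (Measure.prod_eq fun U D hU hD => ?_).symm
  set γ := Measure.pi fun i => gammaShape (a i)
  have hR : MeasurableSet ((ratio : (ι → ℝ) → ι → ℝ) ⁻¹' D) := measurable_ratio hD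
  have key : (γ.restrict (ratio ⁻¹' D)).map (fun g => ∑ i, g i)
      = dirichletDist a D • gammaShape (∑ i, a i) := by
    have : IsFiniteMeasure (dirichletDist a D • gammaShape (∑ i, a i)) :=
      Measure.smul_finite _ (measure_ne_top _ _)
    refine measure_ext_of_laplace ?_ (Measure.ae_smul_measure (ae_nonneg_gammaShape _) _)
      fun n => ?_
    · rw [ae_map_iff hs.aemeasurable measurableSet_Ici]
      refine ae_restrict_of_ae ?_
      filter_upwards [ae_nonneg_pi_gammaShape a] with g hg
      exact Finset.sum_nonneg fun i _ => hg i
    · have h3 := congrArg (fun m => m (ratio ⁻¹' D))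
        (pi_gammaShape_withDensity_exp ha (Nat.cast_nonneg (α := ℝ) n))
      simp only [Measure.smul_apply, smul_eq_mul] at h3
      have hpre : (fun (g : ι → ℝ) i => g i / (1 + (n : ℝ))) ⁻¹' (ratio ⁻¹' D) = ratio ⁻¹' D := by
        ext g
        simp only [Set.mem_preimage]
        rw [ratio_div g (by positivity)]
      rw [withDensity_apply _ hR, Measure.map_apply (by fun_prop) hR, hpre] at h3
      rw [lintegral_map (by fun_prop) hs, h3, lintegral_smul_measure,
        lintegral_exp_gammaShape (Finset.sum_nonneg fun i _ => ha i) (by positivity),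
        dirichletDist_eq, Measure.map_apply measurable_ratio hD, smul_eq_mul, mul_comm]
  have h4 := congrArg (fun m => m U) key
  simp only [Measure.smul_apply, smul_eq_mul] at h4
  rw [Measure.map_apply hs hU, Measure.restrict_apply (hs hU)] at h4
  rw [Measure.map_apply (hs.prodMk measurable_ratio) (hU.prod hD), mul_comm, ← h4]
  rfl

variable [DecidableEq ι]

theorem lintegral_pi_gammaShape_mul {a : ι → ℝ} (ha : ∀ i, 0 ≤ a i) (j : ι) {f : (ι → ℝ) → ℝ≥0∞}
    (hf : Measurable f) :
    ∫⁻ g, ENNReal.ofReal (g j) * f g ∂(Measure.pi fun i => gammaShape (a i))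
      = ENNReal.ofReal (a j) *
        ∫⁻ g, f g ∂(Measure.pi fun i => gammaShape ((a + Pi.single j 1 : ι → ℝ) i)) := by
  let w : ι → ℝ → ℝ≥0∞ := fun i x => if i = j then ENNReal.ofReal x else 1
  let c : ι → ℝ≥0∞ := fun i => if i = j then ENNReal.ofReal (a j) else 1
  have hw : ∀ i, Measurable (w i) := fun i => by
    by_cases h : i = j <;> simp only [w, h, if_true, if_false] <;> fun_prop
  have h1 : ∀ i, (gammaShape (a i)).withDensity (w i)
      = c i • gammaShape ((a + Pi.single j 1 : ι → ℝ) i) := by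
    intro i
    by_cases h : i = j
    · subst h
      simpa [w, c] using gammaShape_withDensity_id (ha i)
    · have : w i = 1 := by ext x; simp [w, h]
      rw [this, withDensity_one]
      simp [c, h]
  have hc : ∀ i, c i ≠ ∞ := fun i => by by_cases h : i = j <;> simp [c, h]
  have : ∀ i, IsFiniteMeasure ((gammaShape (a i)).withDensity (w i)) := fun i => by
    rw [h1 i]; exact Measure.smul_finite _ (hc i)
  have h2 := pi_withDensity (fun i => gammaShape (a i)) w hw
  simp_rw [h1] at h2
  rw [pi_smul_measure _ c hc] at h2
  have hwp : ∀ g : ι → ℝ, ∏ i, w i (g i) = ENNReal.ofReal (g j) := fun g => by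
    simp [w, Finset.prod_ite_eq']
  have hcp : ∏ i, c i = ENNReal.ofReal (a j) := by simp [c, Finset.prod_ite_eq']
  simp_rw [hwp] at h2
  rw [hcp] at h2
  rw [← smul_eq_mul, ← lintegral_smul_measure, ← h2,
    lintegral_withDensity_eq_lintegral_mul _ (by fun_prop) hf]
  rfl

/-- The independent sum has mean ∑ a i. Multiplying by it turns the ratio x j back into the Gamma
coordinate g j, whose size biasing raises the j-th shape. -/
theorem lintegral_dirichletDist_mul {a : ι → ℝ} (ha : ∀ i, 0 ≤ a i) (j : ι) {f : (ι → ℝ) → ℝ≥0∞}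
    (hf : Measurable f) :
    ENNReal.ofReal (∑ i, a i) * ∫⁻ x, ENNReal.ofReal (x j) * f x ∂dirichletDist a
      = ENNReal.ofReal (a j) * ∫⁻ x, f x ∂dirichletDist (a + Pi.single j 1) := by
  have hs : Measurable fun g : ι → ℝ => ∑ i, g i := by fun_prop
  have hF : Measurable fun x : ι → ℝ => ENNReal.ofReal (x j) * f x := by fun_prop
  rw [← lintegral_ofReal_gammaShape (Finset.sum_nonneg fun i _ => ha i),
    ← lintegral_prod_mul ENNReal.measurable_ofReal.aemeasurable hF.aemeasurable, ← pi_gammaShape_map_sum_ratio ha,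
    lintegral_map (by fun_prop) (hs.prodMk measurable_ratio), dirichletDist_eq,
    lintegral_map hf measurable_ratio]
  refine Eq.trans ?_ (lintegral_pi_gammaShape_mul ha j (hf.comp measurable_ratio))
  refine lintegral_congr_ae ?_
  filter_upwards [ae_nonneg_pi_gammaShape a] with g hg
  have h0 : 0 ≤ ∑ i, g i := Finset.sum_nonneg fun i _ => hg i
  rw [← mul_assoc, ← ENNReal.ofReal_mul h0]
  congr 2
  change (∑ i, g i) * (g j / ∑ i, g i) = g j
  -- When the sum vanishes, the ratio is 0 by the convention for division, and so is each
  -- nonnegative coordinate.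
  by_cases h : ∑ i, g i = 0
  · rw [h, (Finset.sum_eq_zero_iff_of_nonneg fun i _ => hg i).1 h j (Finset.mem_univ j)]
    simp
  · field_simp

theorem pi_gammaShape_prod_map_add {a : ι → ℝ} (ha : ∀ i, 0 ≤ a i) (j : ι) :
    ((Measure.pi fun i => gammaShape (a i)).prod (gammaShape 1)).map
        (fun p => p.1 + Pi.single j p.2)
      = Measure.pi fun i => gammaShape ((a + Pi.single j 1 : ι → ℝ) i) := by
  have hm : Measurable fun p : (ι → ℝ) × ℝ => p.1 + Pi.single j p.2 := by
    refine measurable_fst.add (measurable_pi_lambda _ fun i => ?_)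
    by_cases h : i = j
    · subst h; simpa using measurable_snd
    · simp [h]
  refine (Measure.pi_eq fun s hs => ?_).symm
  have hS := MeasurableSet.univ_pi hs
  rw [Measure.map_apply hm hS, Measure.prod_apply_symm (hm hS)]
  have h1 : ∀ w : ℝ, (Measure.pi fun i => gammaShape (a i))
      ((fun g => (g, w)) ⁻¹' ((fun p : (ι → ℝ) × ℝ => p.1 + Pi.single j p.2) ⁻¹' Set.univ.pi s))
      = gammaShape (a j) ((fun x => x + w) ⁻¹' s j)
        * ∏ i ∈ Finset.univ.erase j, gammaShape (a i) (s i) := by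
    intro w
    have : ((fun g => (g, w)) ⁻¹' ((fun p : (ι → ℝ) × ℝ => p.1 + Pi.single j p.2) ⁻¹'
        Set.univ.pi s)) = Set.univ.pi (fun i => if i = j then (fun x => x + w) ⁻¹' s j else s i) := by
      ext g
      simp only [Set.mem_preimage, Set.mem_pi, Set.mem_univ, true_implies, Pi.add_apply]
      refine forall_congr' fun i => ?_
      by_cases h : i = j
      · subst h; simp
      · simp [h]
    rw [this, Measure.pi_pi, ← Finset.mul_prod_erase _ _ (Finset.mem_univ j), if_pos rfl]
    congr 1
    refine Finset.prod_congr rfl fun i hi => ?_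
    rw [if_neg (Finset.ne_of_mem_erase hi)]
  simp_rw [h1]
  have hadd : Measurable fun p : ℝ × ℝ => p.1 + p.2 := by fun_prop
  rw [lintegral_mul_const]
  · rw [← Finset.mul_prod_erase _ _ (Finset.mem_univ j)]
    congr 1
    · rw [Pi.add_apply, Pi.single_eq_same, ← gammaShape_conv (ha j) zero_le_one,
        Measure.map_apply hadd (hs j), Measure.prod_apply_symm (hadd (hs j))]
      rfl
    · refine Finset.prod_congr rfl fun i hi => ?_
      simp [Finset.ne_of_mem_erase hi]
  · exact measurable_measure_prodMk_right (hadd (hs j))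

/-- Adding an independent Gamma(1) variable w to coordinate j raises its shape by one. After
normalisation the old ratios get weight s / (s + w), where the old sum s is independent of them, and
the j-th unit vector gets the remaining weight. -/
theorem dirichletDist_add_single {a : ι → ℝ} (ha : ∀ i, 0 ≤ a i) (j : ι) :
    ((dirichletDist a).prod ((gammaShape (∑ i, a i)).prod (gammaShape 1))).map
        (fun q i => q.2.1 / (q.2.1 + q.2.2) * q.1 i
          + q.2.2 / (q.2.1 + q.2.2) * (Pi.single j 1 : ι → ℝ) i)
      = dirichletDist (a + Pi.single j 1) := by
  set γ := Measure.pi fun i => gammaShape (a i)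
  have hs : Measurable fun g : ι → ℝ => ∑ i, g i := by fun_prop
  have hsr : Measurable fun g : ι → ℝ => (∑ i, g i, ratio g) := hs.prodMk measurable_ratio
  have hT : Measurable fun p : (ι → ℝ) × ℝ => (ratio p.1, (∑ i, p.1 i, p.2)) :=
    (measurable_ratio.comp measurable_fst).prodMk ((hs.comp measurable_fst).prodMk measurable_snd)
  have h1 : (dirichletDist a).prod ((gammaShape (∑ i, a i)).prod (gammaShape 1))
      = (γ.prod (gammaShape 1)).map fun p => (ratio p.1, (∑ i, p.1 i, p.2)) := by
    refine Measure.ext_prod₃ fun {s t u} hs' ht hu => ?_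
    rw [Measure.map_apply hT (hs'.prod (ht.prod hu))]
    have : (fun p : (ι → ℝ) × ℝ => (ratio p.1, (∑ i, p.1 i, p.2))) ⁻¹' (s ×ˢ t ×ˢ u)
        = ((fun g : ι → ℝ => (∑ i, g i, ratio g)) ⁻¹' (t ×ˢ s)) ×ˢ u := by
      ext p
      simp only [Set.mem_preimage, Set.mem_prod]
      tauto
    rw [this, Measure.prod_prod, Measure.prod_prod, Measure.prod_prod,
      ← Measure.map_apply hsr (ht.prod hs'), pi_gammaShape_map_sum_ratio ha, Measure.prod_prod]
    ring
  have hG : Measurable fun (q : (ι → ℝ) × ℝ × ℝ) i => q.2.1 / (q.2.1 + q.2.2) * q.1 i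
          + q.2.2 / (q.2.1 + q.2.2) * (Pi.single j 1 : ι → ℝ) i := by fun_prop
  have hm : Measurable fun p : (ι → ℝ) × ℝ => p.1 + Pi.single j p.2 := by
    refine measurable_fst.add (measurable_pi_lambda _ fun i => ?_)
    by_cases h : i = j
    · subst h; simpa using measurable_snd
    · simp [h]
  rw [h1, Measure.map_map hG hT, dirichletDist_eq, ← pi_gammaShape_prod_map_add ha j,
    Measure.map_map measurable_ratio hm]
  refine Measure.map_congr ?_
  filter_upwards [Measure.quasiMeasurePreserving_fst.ae (ae_nonneg_pi_gammaShape a)] with p hp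
  ext i
  simp only [Function.comp_apply, ratio, Pi.add_apply]
  rw [Finset.sum_add_distrib, Finset.sum_pi_single' j p.2 Finset.univ, if_pos (Finset.mem_univ j)]
  have h5 : (∑ i, p.1 i) * (p.1 i / ∑ i, p.1 i) = p.1 i := by
    by_cases h : ∑ i, p.1 i = 0
    · rw [h, (Finset.sum_eq_zero_iff_of_nonneg fun i _ => hp i).1 h i (Finset.mem_univ i)]
      simp
    · field_simp
  have h6 : (Pi.single j p.2 : ι → ℝ) i = p.2 * (Pi.single j 1 : ι → ℝ) i := by
    by_cases h : i = j
    · subst h; simp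
    · simp [h]
  rw [h6, add_div, div_mul_eq_mul_div, h5, div_mul_eq_mul_div]

end Dirichlet

/-! ### Measurability of integrals and of product measures -/

section Auxiliary

theorem measurable_lintegral_of_le {X Y : Type*} [MeasurableSpace X] [MeasurableSpace Y]
    {m : X → Measure Y} (hm : Measurable m) {C : ℝ≥0∞} (hC : C ≠ ∞) (hmC : ∀ x, m x Set.univ ≤ C)
    {f : X × Y → ℝ≥0∞} (hf : Measurable f) : Measurable fun x => ∫⁻ y, f (x, y) ∂m x := by
  let K : Kernel X Y := ⟨m, hm⟩
  have : IsFiniteKernel K := ⟨⟨C, hC.lt_top, hmC⟩⟩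
  exact Measurable.lintegral_kernel_prod_right (κ := K) (f := fun x y => f (x, y)) hf

theorem measurable_snoc {E : Type*} [MeasurableSpace E] {N : ℕ} :
    Measurable fun p : (Fin N → E) × E => (Fin.snoc p.1 p.2 : Fin (N + 1) → E) := by
  refine measurable_pi_lambda _ fun i => ?_
  induction i using Fin.lastCases with
  | last => simpa using measurable_snd
  | cast j =>
    simp only [Fin.snoc_castSucc]
    fun_prop

theorem lintegral_pi_snoc {E : Type*} [MeasurableSpace E] {N : ℕ} (ν : Measure E)
    [IsProbabilityMeasure ν] {f : (Fin (N + 1) → E) → ℝ≥0∞} (hf : Measurable f) :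
    ∫⁻ x, f x ∂(Measure.pi fun _ => ν)
      = ∫⁻ x, ∫⁻ z, f (Fin.snoc x z) ∂ν ∂(Measure.pi fun _ : Fin N => ν) := by
  have h := (measurePreserving_piFinSuccAbove (fun _ : Fin (N + 1) => ν) (Fin.last N)).symm
  rw [← h.map_eq, lintegral_map hf (MeasurableEquiv.measurable _), lintegral_prod_symm
    (fun a => f ((MeasurableEquiv.piFinSuccAbove (fun _ => E) (Fin.last N)).symm a))
    (hf.comp (MeasurableEquiv.measurable _)).aemeasurable]
  refine lintegral_congr fun x => lintegral_congr fun z => ?_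
  congr 1
  exact Fin.insertNth_last' z x

theorem measurable_pi_measure {E : Type*} [MeasurableSpace E] (N : ℕ) :
    Measurable fun ν : ProbabilityMeasure E => Measure.pi fun _ : Fin N => (ν : Measure E) := by
  refine Measurable.measure_of_isPiSystem_of_isProbabilityMeasure generateFrom_pi.symm
    isPiSystem_pi ?_
  rintro _ ⟨s, hs, rfl⟩
  simp_rw [Measure.pi_pi]
  refine Finset.measurable_fun_prod _ fun i _ => ?_
  exact (Measure.measurable_coe (hs i (Set.mem_univ i))).comp measurable_subtype_coe

end Auxiliary

/-! ### Cylinder sets of probability measures -/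

section Cylinder

open Classical in
/-- The partition of the space into the complement of a set and the set. -/
noncomputable def indPart {E : Type*} (B : Set E) (x : E) : Fin (1 + 1) := if x ∈ B then 1 else 0

theorem indPart_preimage_one {E : Type*} (B : Set E) : indPart B ⁻¹' {1} = B := by
  ext x
  by_cases h : x ∈ B <;> simp [indPart, h]

variable {E : Type*} [MeasurableSpace E]

/-- The probabilities that `ν` gives to the cells of the partition defined by `p`. -/
noncomputable def cells {d : ℕ} (p : E → Fin (d + 1)) (ν : ProbabilityMeasure E) :
    Fin (d + 1) → ℝ :=
  fun i => (ν : Measure E).real (p ⁻¹' {i})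

theorem measurable_cells {d : ℕ} {p : E → Fin (d + 1)} (hp : Measurable p) :
    Measurable (cells p) := by
  refine measurable_pi_lambda _ fun i => ?_
  exact ((Measure.measurable_coe (hp (measurableSet_singleton i))).comp
    measurable_subtype_coe).ennreal_toReal

theorem cells_comp {d n : ℕ} {r : E → Fin (n + 1)} (hr : Measurable r)
    (f : Fin (n + 1) → Fin (d + 1)) (ν : ProbabilityMeasure E) :
    cells (f ∘ r) ν = fun i => ∑ k with f k = i, cells r ν k := by
  ext i
  simp only [cells]
  rw [← measureReal_biUnion_finset]
  · congr 1
    ext x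
    simp
  · intro k _ l _ hkl
    exact Set.disjoint_left.2 fun x hx hx' => hkl (hx.symm.trans hx')
  · exact fun k _ => hr (measurableSet_singleton k)

/-- The pair of labels (p, q), renumbered, is a common refinement. It makes the cylinders a π-system
and lets any measurable set be adjoined to a partition. -/
theorem exists_refinement {d e : ℕ} {p : E → Fin (d + 1)} (hp : Measurable p)
    {q : E → Fin (e + 1)} (hq : Measurable q) :
    ∃ (n : ℕ) (r : E → Fin (n + 1)) (f : Fin (n + 1) → Fin (d + 1))
      (g : Fin (n + 1) → Fin (e + 1)), Measurable r ∧ p = f ∘ r ∧ q = g ∘ r := by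
  have hc : Fintype.card (Fin (d + 1) × Fin (e + 1)) = ((d + 1) * (e + 1) - 1) + 1 := by
    simp only [Fintype.card_prod, Fintype.card_fin]
    have : 0 < (d + 1) * (e + 1) := by positivity
    omega
  let φ := Fintype.equivFinOfCardEq hc
  refine ⟨(d + 1) * (e + 1) - 1, fun x => φ (p x, q x), fun k => (φ.symm k).1,
    fun k => (φ.symm k).2, ?_, ?_, ?_⟩
  · exact (measurable_of_finite φ).comp (hp.prodMk hq)
  · ext x; simp
  · ext x; simp

/-- The sets of probability measures described by the probabilities of the cells of a finite
measurable partition. -/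
def cylinders (E : Type*) [MeasurableSpace E] : Set (Set (ProbabilityMeasure E)) :=
  {s | ∃ (d : ℕ) (p : E → Fin (d + 1)) (D : Set (Fin (d + 1) → ℝ)),
    Measurable p ∧ MeasurableSet D ∧ s = cells p ⁻¹' D}

theorem measurable_cellSums {d n : ℕ} (f : Fin (n + 1) → Fin (d + 1)) :
    Measurable fun (v : Fin (n + 1) → ℝ) i => ∑ k with f k = i, v k := by fun_prop

theorem isPiSystem_cylinders : IsPiSystem (cylinders E) := by
  rintro _ ⟨d, p, D, hp, hD, rfl⟩ _ ⟨e, q, D', hq, hD', rfl⟩ -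
  obtain ⟨n, r, f, g, hr, rfl, rfl⟩ := exists_refinement hp hq
  refine ⟨n, r, (fun v i => ∑ k with f k = i, v k) ⁻¹' D ∩
    (fun v i => ∑ k with g k = i, v k) ⁻¹' D', hr,
    (measurable_cellSums f hD).inter (measurable_cellSums g hD'), ?_⟩
  ext ν
  simp [cells_comp hr]

theorem univ_mem_cylinders : Set.univ ∈ cylinders E :=
  ⟨0, fun _ => 0, Set.univ, measurable_const, MeasurableSet.univ, by simp⟩

theorem measurable_indPart {B : Set E} (hB : MeasurableSet B) : Measurable (indPart B) :=
  Measurable.ite hB measurable_const measurable_const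

theorem generateFrom_cylinders :
    (inferInstance : MeasurableSpace (ProbabilityMeasure E))
      = MeasurableSpace.generateFrom (cylinders E) := by
  refine le_antisymm ?_ ?_
  · refine Measurable.comap_le (m₁ := MeasurableSpace.generateFrom (cylinders E)) ?_
    refine @Measure.measurable_of_measurable_coe _ _ _ (MeasurableSpace.generateFrom (cylinders E))
      _ fun B hB => ?_
    have h1 : @Measurable _ _ (MeasurableSpace.generateFrom (cylinders E)) _
        (cells (indPart B)) := fun D hD =>
      MeasurableSpace.measurableSet_generateFrom
        ⟨1, indPart B, D, measurable_indPart hB, hD, rfl⟩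
    have h2 : (fun ν : ProbabilityMeasure E => (ν : Measure E) B)
        = fun ν => ENNReal.ofReal (cells (indPart B) ν 1) := by
      ext ν
      simp [cells, indPart_preimage_one]
    change @Measurable _ _ (MeasurableSpace.generateFrom (cylinders E)) _
      (fun ν : ProbabilityMeasure E => (ν : Measure E) B)
    rw [h2]
    exact ENNReal.measurable_ofReal.comp ((measurable_pi_apply 1).comp h1)
  · refine MeasurableSpace.generateFrom_le ?_
    rintro _ ⟨d, p, D, hp, hD, rfl⟩
    exact measurable_cells hp hD

end Cylinder

/-! ### Dirichlet processes and the addition of an atom -/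

section DirichletProcess

variable {E : Type*} [MeasurableSpace E] {α : Measure E} {Q : Measure (ProbabilityMeasure E)}

theorem IsDirichletLaw.map_cells (h : IsDirichletLaw α Q) {d : ℕ} {p : E → Fin (d + 1)}
    (hp : Measurable p) :
    Q.map (cells p) = dirichletDist fun i => α.real (p ⁻¹' {i}) := by
  refine h.fdd d (fun i => p ⁻¹' {i}) (fun i => hp (measurableSet_singleton i)) ?_ ?_
  · intro i j hij
    exact Set.disjoint_left.2 fun x hx hx' => hij (hx.symm.trans hx')
  · ext x; simp

theorem IsDirichletLaw.isProbabilityMeasure (h : IsDirichletLaw α Q) : IsProbabilityMeasure Q := by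
  have h1 := h.map_cells (p := fun _ => (0 : Fin (0 + 1))) measurable_const
  constructor
  have h2 : Q.map (cells fun _ => (0 : Fin (0 + 1))) Set.univ = 1 := by
    rw [h1]; exact measure_univ
  rwa [Measure.map_apply (measurable_cells measurable_const) MeasurableSet.univ] at h2

theorem IsDirichletLaw.of_cells [IsFiniteMeasure α] (h0 : α ≠ 0)
    (h : ∀ (d : ℕ) (p : E → Fin (d + 1)), Measurable p →
      Q.map (cells p) = dirichletDist fun i => α.real (p ⁻¹' {i})) :
    IsDirichletLaw α Q := by
  refine ⟨inferInstance, h0, fun d B hB hd hU => ?_⟩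
  have hex : ∀ x, ∃ i, x ∈ B i := fun x => by
    have : x ∈ ⋃ i, B i := hU ▸ Set.mem_univ x
    simpa using this
  choose p hp using hex
  have hpre : ∀ i, p ⁻¹' {i} = B i := by
    intro i
    ext x
    refine ⟨fun hx => ?_, fun hx => ?_⟩
    · have : p x = i := hx
      exact this ▸ hp x
    · by_contra hne
      exact Set.disjoint_left.1 (hd hne) (hp x) hx
  have hpm : Measurable p := measurable_to_countable' fun i => by rw [hpre]; exact hB i
  have := h d p hpm
  simp only [hpre] at this
  rw [← this]
  congr 1
  ext ν i
  simp [cells, hpre]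

theorem isDirichletLaw_dirichletLaw (h : IsDirichletLaw α Q) :
    IsDirichletLaw α (dirichletLaw α) := by
  have hex : ∃ Q, IsDirichletLaw α Q := ⟨Q, h⟩
  rw [dirichletLaw, dif_pos hex]
  exact hex.choose_spec

theorem isDirichletLaw_of_ne_zero (h : dirichletLaw α ≠ 0) :
    IsDirichletLaw α (dirichletLaw α) := by
  by_cases hex : ∃ Q, IsDirichletLaw α Q
  · exact isDirichletLaw_dirichletLaw hex.choose_spec
  · exact absurd (by rw [dirichletLaw, dif_neg hex]) h

/-- The mixture of `ν` and the point mass at `x` with weights `s / (s + w)` and `w / (s + w)`. -/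
noncomputable def mixDirac (x : E) (q : ProbabilityMeasure E × ℝ × ℝ) : ProbabilityMeasure E :=
  ⟨unitInterval.toNNReal (Set.projIcc 0 1 zero_le_one (q.2.1 / (q.2.1 + q.2.2))) •
      (q.1 : Measure E) +
    unitInterval.toNNReal
      (unitInterval.symm (Set.projIcc 0 1 zero_le_one (q.2.1 / (q.2.1 + q.2.2)))) •
      Measure.dirac x, inferInstance⟩

theorem measurable_mixDirac (x : E) : Measurable (mixDirac x) := by
  refine Measurable.subtype_mk ?_
  refine Measure.measurable_of_measurable_coe _ fun B hB => ?_
  have h1 : Measurable fun q : ProbabilityMeasure E × ℝ × ℝ =>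
      Set.projIcc (0 : ℝ) 1 zero_le_one (q.2.1 / (q.2.1 + q.2.2)) :=
    continuous_projIcc.measurable.comp (by fun_prop)
  have h2 : Measurable fun q : ProbabilityMeasure E × ℝ × ℝ => (q.1 : Measure E) B :=
    (Measure.measurable_coe hB).comp (measurable_subtype_coe.comp measurable_fst)
  have h3 : Measurable unitInterval.toNNReal := continuous_subtype_val.measurable.subtype_mk
  have h4 : Measurable unitInterval.symm := unitInterval.continuous_symm.measurable
  simp only [Measure.add_apply, Measure.smul_apply, ENNReal.smul_def, smul_eq_mul]
  exact ((h3.comp h1).coe_nnreal_ennreal.mul h2).add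
    ((h3.comp (h4.comp h1)).coe_nnreal_ennreal.mul measurable_const)

/-- For such s and w the weight already lies in the unit interval, so the projection in `mixDirac`,
present only to make it total, does nothing. -/
theorem cells_mixDirac {d : ℕ} {p : E → Fin (d + 1)} (hp : Measurable p) (x : E)
    (ν : ProbabilityMeasure E) {s w : ℝ} (hs : 0 ≤ s) (hw : 0 < w) :
    cells p (mixDirac x (ν, s, w)) = fun i => s / (s + w) * cells p ν i
      + w / (s + w) * (Pi.single (p x) 1 : Fin (d + 1) → ℝ) i := by
  have hsw : 0 < s + w := by linarith
  have hI : s / (s + w) ∈ Set.Icc (0 : ℝ) 1 :=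
    ⟨by positivity, (div_le_one hsw).2 (by linarith)⟩
  ext i
  simp only [cells, mixDirac, ProbabilityMeasure.coe_mk]
  rw [Set.projIcc_of_mem _ hI, measureReal_add_apply, measureReal_nnreal_smul_apply,
    measureReal_nnreal_smul_apply]
  congr 1
  congr 1
  · simp only [unitInterval.coe_toNNReal, unitInterval.coe_symm_eq]
    field_simp
    ring
  · by_cases h : p x = i
    · subst h
      simp [measureReal_def]
    · simp [measureReal_def, hp (measurableSet_singleton i), h, Ne.symm h]

theorem sum_measureReal_preimage [IsFiniteMeasure α] {d : ℕ} {p : E → Fin (d + 1)}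
    (hp : Measurable p) : ∑ i, α.real (p ⁻¹' {i}) = α.real Set.univ := by
  rw [← measureReal_biUnion_finset]
  · congr 1
    ext x
    simp
  · intro k _ l _ hkl
    exact Set.disjoint_left.2 fun x hx hx' => hkl (hx.symm.trans hx')
  · exact fun k _ => hp (measurableSet_singleton k)

theorem measureReal_add_dirac [IsFiniteMeasure α] {d : ℕ} {p : E → Fin (d + 1)}
    (hp : Measurable p) (x : E) :
    (fun i => (α + Measure.dirac x).real (p ⁻¹' {i}))
      = (fun i => α.real (p ⁻¹' {i})) + (Pi.single (p x) 1 : Fin (d + 1) → ℝ) := by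
  ext i
  rw [measureReal_add_apply, Pi.add_apply]
  congr 1
  by_cases h : p x = i
  · subst h
    simp [measureReal_def]
  · simp [measureReal_def, hp (measurableSet_singleton i), h, Ne.symm h]

/-- Existence passes from α to α + δ_x: mix a draw from 𝒟(α) with δ_x, using weights built from
independent Gamma variables of shapes α(E) and 1. On each partition this is
`dirichletDist_add_single`. Thus all posterior laws exist as soon as 𝒟(α) does. -/
theorem IsDirichletLaw.add_dirac (h : IsDirichletLaw α Q) (x : E) :
    IsDirichletLaw (α + Measure.dirac x) (dirichletLaw (α + Measure.dirac x)) := by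
  have := h.finite
  have := h.isProbabilityMeasure
  refine isDirichletLaw_dirichletLaw
    (Q := (Q.prod ((gammaShape (α.real Set.univ)).prod (gammaShape 1))).map (mixDirac x))
    (IsDirichletLaw.of_cells ?_ fun d p hp => ?_)
  · intro h0
    have := congrArg (fun m => m Set.univ) h0
    simp at this
  · have hc := measurable_cells hp
    rw [Measure.map_map hc (measurable_mixDirac x), measureReal_add_dirac hp,
      ← dirichletDist_add_single (fun i => measureReal_nonneg), sum_measureReal_preimage hp,
      ← h.map_cells hp]
    have hpm : (Q.map (cells p)).prod ((gammaShape (α.real Set.univ)).prod (gammaShape 1))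
        = (Q.prod ((gammaShape (α.real Set.univ)).prod (gammaShape 1))).map
          (Prod.map (cells p) id) := by
      rw [← Measure.map_prod_map _ _ hc measurable_id, Measure.map_id]
    rw [hpm, Measure.map_map (by fun_prop) (hc.prodMap measurable_id)]
    refine Measure.map_congr ?_
    have h1 : ∀ᵐ q ∂((gammaShape (α.real Set.univ)).prod (gammaShape 1)),
        0 ≤ q.1 ∧ 0 < q.2 := by
      filter_upwards [Measure.quasiMeasurePreserving_fst.ae (ae_nonneg_gammaShape _),
        Measure.quasiMeasurePreserving_snd.ae (ae_nonneg_gammaShape _),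
        Measure.quasiMeasurePreserving_snd.ae (ae_ne_zero_gammaShape one_pos)] with q h2 h3 h4
      exact ⟨h2, lt_of_le_of_ne h3 (Ne.symm h4)⟩
    filter_upwards [Measure.quasiMeasurePreserving_snd.ae h1] with q hq
    exact cells_mixDirac hp x q.1 hq.1 hq.2

end DirichletProcess

/-! ### Conjugacy and the Pólya urn -/

section Posterior

variable {E : Type*} [MeasurableSpace E] {α : Measure E}

/-- The posterior parameter `α + ∑ n, δ_{x n}`. -/
noncomputable def posterior (α : Measure E) {N : ℕ} (x : Fin N → E) : Measure E :=
  α + ∑ n, Measure.dirac (x n)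

theorem posterior_snoc {N : ℕ} (x : Fin N → E) (z : E) :
    posterior α (Fin.snoc x z : Fin (N + 1) → E) = posterior α x + Measure.dirac z := by
  simp [posterior, Fin.sum_univ_castSucc, add_assoc]

theorem posterior_univ {N : ℕ} (x : Fin N → E) :
    posterior α x Set.univ = α Set.univ + N := by
  simp [posterior]

theorem measurable_posterior {N : ℕ} : Measurable (posterior α : (Fin N → E) → Measure E) := by
  refine Measure.measurable_of_measurable_coe _ fun B hB => ?_
  simp only [posterior, Measure.add_apply, Measure.finsetSum_apply]
  refine measurable_const.add (Finset.measurable_fun_sum _ fun n _ => ?_)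
  exact (Measure.measurable_coe hB).comp (Measure.measurable_dirac.comp (measurable_pi_apply n))

theorem IsDirichletLaw.posterior (h : IsDirichletLaw α (dirichletLaw α)) {N : ℕ}
    (x : Fin N → E) : IsDirichletLaw (posterior α x) (dirichletLaw (posterior α x)) := by
  induction N with
  | zero =>
    have : NDP.posterior α x = α := by simp [NDP.posterior]
    rwa [this]
  | succ N ih =>
    rw [← Fin.snoc_init_self x, posterior_snoc]
    exact (ih (Fin.init x)).add_dirac _

/-- The laws are selected by choice for each x separately, but the mass of a cylinder depends on x
only through the finitely many possible labels p (x n), and cylinders generate. -/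
theorem measurable_dirichletLaw_posterior (h : IsDirichletLaw α (dirichletLaw α)) {N : ℕ} :
    Measurable fun x : Fin N → E => dirichletLaw (posterior α x) := by
  have := fun x : Fin N → E => (h.posterior x).isProbabilityMeasure
  have := h.finite
  refine Measurable.measure_of_isPiSystem_of_isProbabilityMeasure generateFrom_cylinders
    isPiSystem_cylinders ?_
  rintro _ ⟨d, p, D, hp, hD, rfl⟩
  let G : (Fin N → Fin (d + 1)) → ℝ≥0∞ := fun v =>
    dirichletDist (fun i => α.real (p ⁻¹' {i}) + ∑ n, if v n = i then (1 : ℝ) else 0) D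
  have h1 : (fun x : Fin N → E => dirichletLaw (posterior α x) (cells p ⁻¹' D))
      = G ∘ fun x n => p (x n) := by
    ext x
    rw [← Measure.map_apply (measurable_cells hp) hD, (h.posterior x).map_cells hp]
    simp only [G, Function.comp_apply]
    congr 2
    ext i
    have hsum : (∑ n, Measure.dirac (x n)).real (p ⁻¹' {i})
        = ∑ n, (Measure.dirac (x n)).real (p ⁻¹' {i}) := by
      simp only [measureReal_def, Measure.finsetSum_apply]
      exact ENNReal.toReal_sum fun n _ => measure_ne_top _ _
    rw [NDP.posterior, measureReal_add_apply, hsum]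
    congr 1
    refine Finset.sum_congr rfl fun n _ => ?_
    by_cases hi : p (x n) = i <;>
      simp [measureReal_def, hp (measurableSet_singleton i), hi]
  rw [h1]
  exact (measurable_of_finite G).comp
    (measurable_pi_lambda _ fun n => hp.comp (measurable_pi_apply n))

theorem measurable_dirichletLaw_add_dirac (h : IsDirichletLaw α (dirichletLaw α)) :
    Measurable fun x : E => dirichletLaw (α + Measure.dirac x) := by
  have h1 := (measurable_dirichletLaw_posterior h (N := 1)).comp
    (measurable_pi_lambda (fun (x : E) (_ : Fin 1) => x) fun _ => measurable_id)
  convert! h1 using 2 with x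
  simp [posterior]

/-- Refine the partition so that C is a union of cells. Then ν(C) is a sum of coordinates of a
Dirichlet vector, and weighting by coordinate k raises parameter k, which is the effect of an atom
in cell k. -/
theorem lintegral_rectangle (h : IsDirichletLaw α (dirichletLaw α)) {C : Set E}
    (hC : MeasurableSet C) {d : ℕ} {q : E → Fin (d + 1)} (hq : Measurable q)
    {D : Set (Fin (d + 1) → ℝ)} (hD : MeasurableSet D) :
    α Set.univ * ∫⁻ ν in cells q ⁻¹' D, (ν : Measure E) C ∂dirichletLaw α
      = ∫⁻ x in C, dirichletLaw (α + Measure.dirac x) (cells q ⁻¹' D) ∂α := by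
  have := h.finite
  obtain ⟨n, r, f, g, hr, hfr, rfl⟩ := exists_refinement (measurable_indPart hC) hq
  set D' : Set (Fin (n + 1) → ℝ) := (fun v i => ∑ k with g k = i, v k) ⁻¹' D with hD'
  have hD'm : MeasurableSet D' := measurable_cellSums g hD
  have hpre : cells (g ∘ r) ⁻¹' D = cells r ⁻¹' D' := by
    ext ν
    simp [hD', cells_comp hr]
  have hcr := measurable_cells hr
  have hmem : ∀ x, x ∈ C ↔ f (r x) = 1 := fun x => by
    rw [← Function.comp_apply (f := f), ← hfr, ← Set.mem_singleton_iff, ← Set.mem_preimage,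
      indPart_preimage_one]
  set a : Fin (n + 1) → ℝ := fun k => α.real (r ⁻¹' {k}) with ha
  have hCν : ∀ ν : ProbabilityMeasure E,
      (ν : Measure E) C = ∑ k with f k = 1, ENNReal.ofReal (cells r ν k) := by
    intro ν
    have hCu : C = ⋃ k ∈ Finset.univ.filter (fun k => f k = 1), r ⁻¹' {k} := by
      ext x; simp [hmem]
    rw [hCu, measure_biUnion_finset]
    · simp [cells]
    · intro k _ l _ hkl
      exact Set.disjoint_left.2 fun x hx hx' => hkl (hx.symm.trans hx')
    · exact fun k _ => hr (measurableSet_singleton k)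
  have hL : α Set.univ * ∫⁻ ν in cells r ⁻¹' D', (ν : Measure E) C ∂dirichletLaw α
      = ∑ k with f k = 1, ENNReal.ofReal (a k) * dirichletDist (a + Pi.single k 1) D' := by
    have h1 : ∫⁻ ν in cells r ⁻¹' D', (ν : Measure E) C ∂dirichletLaw α
        = ∑ k with f k = 1, ∫⁻ x, ENNReal.ofReal (x k) * D'.indicator 1 x ∂dirichletDist a := by
      simp_rw [hCν]
      have hmk : ∀ k, Measurable fun ν => ENNReal.ofReal (cells r ν k) := fun k =>
        ENNReal.measurable_ofReal.comp ((measurable_pi_apply k).comp hcr)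
      rw [lintegral_finsetSum _ fun k _ => hmk k]
      refine Finset.sum_congr rfl fun k _ => ?_
      have hmD : Measurable fun x : Fin (n + 1) → ℝ =>
          ENNReal.ofReal (x k) * D'.indicator 1 x :=
        (ENNReal.measurable_ofReal.comp (measurable_pi_apply k)).mul
          (measurable_one.indicator hD'm)
      rw [← h.map_cells hr, lintegral_map hmD hcr,
        ← lintegral_indicator (hcr hD'm)]
      refine lintegral_congr fun ν => ?_
      by_cases hν : cells r ν ∈ D'
      · simp [hν]
      · simp [hν]
    rw [h1, Finset.mul_sum]
    refine Finset.sum_congr rfl fun k _ => ?_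
    rw [← lintegral_indicator_one hD'm, ← lintegral_dirichletDist_mul (a := a)
      (fun i => measureReal_nonneg) k (measurable_one.indicator hD'm), ha,
      sum_measureReal_preimage hr, ofReal_measureReal]
  have hG : ∀ x, dirichletLaw (α + Measure.dirac x) (cells r ⁻¹' D')
      = dirichletDist (a + Pi.single (r x) 1) D' := fun x => by
    rw [← Measure.map_apply hcr hD'm, (h.add_dirac x).map_cells hr, measureReal_add_dirac hr]
  rw [hpre, hL, ← lintegral_indicator hC]
  simp_rw [hG]
  let G : Fin (n + 1) → ℝ≥0∞ := fun k =>
    if f k = 1 then dirichletDist (a + Pi.single k 1) D' else 0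
  have h2 : ∀ x, C.indicator (fun x => dirichletDist (a + Pi.single (r x) 1) D') x
      = G (r x) := by
    intro x
    by_cases hx : x ∈ C
    · simp [G, hx, (hmem x).1 hx]
    · simp [G, hx, mt (hmem x).2 hx]
  simp_rw [h2]
  rw [← lintegral_map (f := G) (measurable_of_finite _) hr, lintegral_fintype, Finset.sum_filter]
  refine Finset.sum_congr rfl fun k _ => ?_
  rw [Measure.map_apply hr (measurableSet_singleton k)]
  simp only [G]
  split_ifs
  · rw [ha, ofReal_measureReal, mul_comm]
  · simp

/-- Conjugacy for one observation: the joint law of (x, ν) disintegrates in either order. Rectangles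
of a measurable set and a cylinder form a generating π-system. -/
theorem lintegral_dirichletLaw_one (h : IsDirichletLaw α (dirichletLaw α))
    {f : E × ProbabilityMeasure E → ℝ≥0∞} (hf : Measurable f) :
    α Set.univ * ∫⁻ ν, ∫⁻ x, f (x, ν) ∂(ν : Measure E) ∂dirichletLaw α
      = ∫⁻ x, ∫⁻ ν, f (x, ν) ∂dirichletLaw (α + Measure.dirac x) ∂α := by
  have := h.finite
  have := h.isProbabilityMeasure
  let K : Kernel (ProbabilityMeasure E) E := ⟨fun ν => (ν : Measure E), measurable_subtype_coe⟩
  have hK : IsMarkovKernel K := ⟨fun ν => inferInstanceAs (IsProbabilityMeasure (ν : Measure E))⟩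
  let L : Kernel E (ProbabilityMeasure E) :=
    ⟨fun x => dirichletLaw (α + Measure.dirac x), measurable_dirichletLaw_add_dirac h⟩
  have hL : IsMarkovKernel L := ⟨fun x => (h.add_dirac x).isProbabilityMeasure⟩
  have key : α Set.univ • (dirichletLaw α ⊗ₘ K).map Prod.swap = α ⊗ₘ L := by
    have hfin : IsFiniteMeasure (α Set.univ • (dirichletLaw α ⊗ₘ K).map Prod.swap) :=
      Measure.smul_finite _ (measure_ne_top _ _)
    refine ext_of_generate_finite _
      (generateFrom_eq_prod MeasurableSpace.generateFrom_measurableSet generateFrom_cylinders.symm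
        isCountablySpanning_measurableSet
        ⟨fun _ => Set.univ, fun _ => univ_mem_cylinders, Set.iUnion_const _⟩).symm
      (MeasurableSpace.isPiSystem_measurableSet.prod isPiSystem_cylinders) ?_ ?_
    · rintro _ ⟨C, hC, _, ⟨d, q, D, hq, hD, rfl⟩, rfl⟩
      rw [Measure.smul_apply, smul_eq_mul, Measure.map_apply measurable_swap
        (hC.prod (measurable_cells hq hD)), Set.preimage_swap_prod,
        Measure.compProd_apply_prod (measurable_cells hq hD) hC,
        Measure.compProd_apply_prod hC (measurable_cells hq hD)]
      exact lintegral_rectangle h hC hq hD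
    · simp [Measure.map_apply measurable_swap]
  have hsw : Measurable fun p : ProbabilityMeasure E × E => f p.swap := hf.comp measurable_swap
  have h1 : ∫⁻ p, f p ∂(α ⊗ₘ L)
      = ∫⁻ x, ∫⁻ ν, f (x, ν) ∂dirichletLaw (α + Measure.dirac x) ∂α :=
    Measure.lintegral_compProd hf
  have h2 : ∫⁻ p, f p.swap ∂(dirichletLaw α ⊗ₘ K)
      = ∫⁻ ν, ∫⁻ x, f (x, ν) ∂(ν : Measure E) ∂dirichletLaw α :=
    Measure.lintegral_compProd hsw
  rw [← h1, ← h2, ← key, lintegral_smul_measure, lintegral_map hf measurable_swap, smul_eq_mul]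

/-- The law of a sample of size `N` from a random probability measure with law `Q`. -/
noncomputable def sampleLaw (Q : Measure (ProbabilityMeasure E)) (N : ℕ) : Measure (Fin N → E) :=
  Q.bind fun ν => Measure.pi fun _ => (ν : Measure E)

theorem lintegral_sampleLaw (Q : Measure (ProbabilityMeasure E)) {N : ℕ}
    {g : (Fin N → E) → ℝ≥0∞} (hg : Measurable g) :
    ∫⁻ x, g x ∂sampleLaw Q N = ∫⁻ ν, ∫⁻ x, g x ∂(Measure.pi fun _ => (ν : Measure E)) ∂Q :=
  Measure.lintegral_bind (measurable_pi_measure N).aemeasurable hg.aemeasurable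

/-- The common step behind conjugacy and the urn: split off the last observation, use conjugacy for
the first N, then the one-observation rule with parameter `posterior α x`, whose total mass is α(E)
+ N. -/
theorem lintegral_dirichletLaw_succ (h : IsDirichletLaw α (dirichletLaw α)) {N : ℕ}
    (ih : ∀ f : (Fin N → E) × ProbabilityMeasure E → ℝ≥0∞, Measurable f →
      ∫⁻ ν, ∫⁻ x, f (x, ν) ∂(Measure.pi fun _ => (ν : Measure E)) ∂dirichletLaw α
        = ∫⁻ x, ∫⁻ ν, f (x, ν) ∂dirichletLaw (posterior α x) ∂sampleLaw (dirichletLaw α) N)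
    {f : (Fin (N + 1) → E) × ProbabilityMeasure E → ℝ≥0∞} (hf : Measurable f) :
    (α Set.univ + N) *
        ∫⁻ ν, ∫⁻ x, f (x, ν) ∂(Measure.pi fun _ => (ν : Measure E)) ∂dirichletLaw α
      = ∫⁻ x, ∫⁻ z, ∫⁻ ν, f (Fin.snoc x z, ν) ∂dirichletLaw (posterior α (Fin.snoc x z :
          Fin (N + 1) → E)) ∂posterior α x ∂sampleLaw (dirichletLaw α) N := by
  have := h.finite
  have hf' : Measurable fun p : ((Fin N → E) × ProbabilityMeasure E) × E =>
      f (Fin.snoc p.1.1 p.2, p.1.2) :=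
    hf.comp ((measurable_snoc.comp (by fun_prop :
      Measurable fun p : ((Fin N → E) × ProbabilityMeasure E) × E => (p.1.1, p.2))).prodMk
      (by fun_prop))
  have h1 : Measurable fun p : (Fin N → E) × ProbabilityMeasure E =>
      ∫⁻ z, f (Fin.snoc p.1 z, p.2) ∂(p.2 : Measure E) :=
    measurable_lintegral_of_le (m := fun p : (Fin N → E) × ProbabilityMeasure E =>
      (p.2 : Measure E)) (measurable_subtype_coe.comp measurable_snd) ENNReal.one_ne_top
      (fun p => by simp) hf'
  have h2 : ∀ ν : ProbabilityMeasure E,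
      ∫⁻ x, f (x, ν) ∂(Measure.pi fun _ => (ν : Measure E))
        = ∫⁻ x, ∫⁻ z, f (Fin.snoc x z, ν) ∂(ν : Measure E)
            ∂(Measure.pi fun _ : Fin N => (ν : Measure E)) := fun ν =>
    lintegral_pi_snoc _ (hf.comp measurable_prodMk_right)
  simp_rw [h2]
  rw [ih _ h1, ← lintegral_const_mul _ (measurable_lintegral_of_le
    (measurable_dirichletLaw_posterior h) ENNReal.one_ne_top
    (fun x => (h.posterior x).isProbabilityMeasure.measure_univ.le) h1)]
  refine lintegral_congr fun x => ?_
  rw [← posterior_univ x, lintegral_dirichletLaw_one (h.posterior x)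
    (f := fun p : E × ProbabilityMeasure E => f (Fin.snoc x p.1, p.2))
    (hf'.comp (by fun_prop : Measurable fun p : E × ProbabilityMeasure E => ((x, p.2), p.1)))]
  simp_rw [posterior_snoc]

theorem ne_zero_and_ne_top (h : IsDirichletLaw α (dirichletLaw α)) (N : ℕ) :
    α Set.univ + N ≠ 0 ∧ α Set.univ + N ≠ ∞ := by
  have := h.finite
  constructor
  · have := (Measure.measure_univ_ne_zero (μ := α)).2 h.ne_zero
    simp [this]
  · exact ENNReal.add_ne_top.2 ⟨measure_ne_top _ _, by simp⟩

/-- Conjugacy of the Dirichlet process, for a sample of size `N`. -/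
theorem lintegral_dirichletLaw_pi (h : IsDirichletLaw α (dirichletLaw α)) {N : ℕ}
    {f : (Fin N → E) × ProbabilityMeasure E → ℝ≥0∞} (hf : Measurable f) :
    ∫⁻ ν, ∫⁻ x, f (x, ν) ∂(Measure.pi fun _ => (ν : Measure E)) ∂dirichletLaw α
      = ∫⁻ x, ∫⁻ ν, f (x, ν) ∂dirichletLaw (posterior α x) ∂sampleLaw (dirichletLaw α) N := by
  induction N with
  | zero =>
    have h0 : ∀ x : Fin 0 → E, posterior α x = α := fun x => by simp [posterior]
    have := h.isProbabilityMeasure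
    have h1 : Measurable fun x : Fin 0 → E => ∫⁻ ν, f (x, ν) ∂dirichletLaw α :=
      hf.lintegral_prod_right'
    simp_rw [h0]
    rw [lintegral_sampleLaw _ h1]
    have h2 : ∀ ν : ProbabilityMeasure E, (Measure.pi fun _ : Fin 0 => (ν : Measure E))
        = Measure.dirac finZeroElim := fun ν => Measure.pi_of_empty _ _
    simp_rw [h2]
    rw [lintegral_dirac' _ h1, lintegral_const, measure_univ, mul_one]
    exact lintegral_congr fun ν => lintegral_dirac' _ (hf.comp measurable_prodMk_right)
  | succ N ih =>
    have hc := ne_zero_and_ne_top h N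
    have hH : Measurable fun x : Fin (N + 1) → E =>
        ∫⁻ ν, f (x, ν) ∂dirichletLaw (posterior α x) :=
      measurable_lintegral_of_le (measurable_dirichletLaw_posterior h) ENNReal.one_ne_top
        (fun x => (h.posterior x).isProbabilityMeasure.measure_univ.le) hf
    -- The recursion is applied to both sides. On the right the integrand is the posterior average
    -- of f, which no longer involves ν, so integrating it over the posterior changes nothing.
    rw [← ENNReal.mul_right_inj hc.1 hc.2, lintegral_dirichletLaw_succ h (fun f hf => ih hf) hf,
      lintegral_sampleLaw _ hH,
      lintegral_dirichletLaw_succ h (fun f hf => ih hf)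
        (f := fun p => ∫⁻ ν, f (p.1, ν) ∂dirichletLaw (posterior α p.1)) (hH.comp measurable_fst)]
    refine lintegral_congr fun x => lintegral_congr fun z => ?_
    have := (h.posterior (Fin.snoc x z : Fin (N + 1) → E)).isProbabilityMeasure
    simp

/-- The Pólya urn recursion for samples from a Dirichlet process. -/
theorem lintegral_sampleLaw_succ (h : IsDirichletLaw α (dirichletLaw α)) {N : ℕ}
    {g : (Fin (N + 1) → E) → ℝ≥0∞} (hg : Measurable g) :
    (α Set.univ + N) * ∫⁻ x, g x ∂sampleLaw (dirichletLaw α) (N + 1)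
      = ∫⁻ x, ∫⁻ z, g (Fin.snoc x z) ∂posterior α x ∂sampleLaw (dirichletLaw α) N := by
  rw [lintegral_sampleLaw _ hg, lintegral_dirichletLaw_succ h
    (fun f hf => lintegral_dirichletLaw_pi h hf) (f := fun p => g p.1) (hg.comp measurable_fst)]
  refine lintegral_congr fun x => lintegral_congr fun z => ?_
  have := (h.posterior (Fin.snoc x z : Fin (N + 1) → E)).isProbabilityMeasure
  simp

end Posterior

/-- Disintegration over the conditioning variable. Mass at most one is enough, which allows for step
laws that degenerate when weights vanish. -/
theorem HasCondLaw.lintegral_eq {Ω X Y : Type*} [MeasurableSpace Ω] [MeasurableSpace X]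
    [MeasurableSpace Y] {P : Measure Ω} [IsProbabilityMeasure P] {U : Ω → Y} {W : Ω → X}
    {k : X → Measure Y} (h : HasCondLaw U W k P) (hk : ∀ x, k x Set.univ ≤ 1)
    {f : X × Y → ℝ≥0∞} (hf : Measurable f) :
    ∫⁻ ω, f (W ω, U ω) ∂P = ∫⁻ ω, ∫⁻ y, f (W ω, y) ∂k (W ω) ∂P := by
  obtain ⟨hm, hc⟩ := h.condDistrib
  let K : Kernel X Y := ⟨k, hm⟩
  have hK : IsFiniteKernel K := ⟨⟨1, ENNReal.one_lt_top, hk⟩⟩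
  have hW := h.measurable_right
  have : IsProbabilityMeasure (P.map W) := Measure.isProbabilityMeasure_map hW.aemeasurable
  have h1 := hc.map_eq
  have h2 : ∫⁻ p, f p ∂(P.map W ⊗ₘ K) = ∫⁻ ω, ∫⁻ y, f (W ω, y) ∂k (W ω) ∂P := by
    rw [Measure.lintegral_compProd hf, lintegral_map (hf.lintegral_kernel_prod_right') hW]
    rfl
  rw [← h2, ← h1, lintegral_map hf (hW.prodMk h.measurable_left)]

/-! ### The importance sampling identity -/

section Simulation

variable {S : Type*} [MeasurableSpace S] {κ ε : ℝ≥0} {ϱ : ProbabilityMeasure S}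

theorem measurable_pi_apply_set {N : ℕ} {A : Set (Fin N → S)} (hA : MeasurableSet A) :
    Measurable fun ν : ProbabilityMeasure S => (Measure.pi fun _ : Fin N => (ν : Measure S)) A :=
  (Measure.measurable_coe hA).comp (measurable_pi_measure N)

theorem isProbabilityMeasure_sampleLaw {E : Type*} [MeasurableSpace E]
    (Q : Measure (ProbabilityMeasure E)) [IsProbabilityMeasure Q] (N : ℕ) :
    IsProbabilityMeasure (sampleLaw Q N) :=
  ⟨by rw [sampleLaw, Measure.bind_apply MeasurableSet.univ (measurable_pi_measure N).aemeasurable]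
      simp⟩

theorem freshLaw_eq {N : ℕ} (ϱN : Measure (Fin N → S)) (A : Set (Fin N → S)) :
    freshLaw ε ϱ ϱN A
      = (ProbabilityTheory.cond ϱN A).bind fun x => dirichletLaw (posterior (ε • (ϱ : Measure S)) x) :=
  rfl

/-- Conjugacy applied to 1_A(x) g(ν): integrating out x first gives ν^N(A), integrating out ν first
gives posteriors averaged over A. This explains the weight κϱ_N(A) of a fresh draw. -/
theorem lintegral_freshLaw
    (h : IsDirichletLaw (ε • (ϱ : Measure S)) (dirichletLaw (ε • (ϱ : Measure S)))) {N : ℕ}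
    {A : Set (Fin N → S)} (hA : MeasurableSet A) {g : ProbabilityMeasure S → ℝ≥0∞}
    (hg : Measurable g) :
    sampleLaw (dirichletLaw (ε • (ϱ : Measure S))) N A *
        ∫⁻ ν, g ν ∂freshLaw ε ϱ (sampleLaw (dirichletLaw (ε • (ϱ : Measure S))) N) A
      = ∫⁻ ν, (Measure.pi fun _ : Fin N => (ν : Measure S)) A * g ν
          ∂dirichletLaw (ε • (ϱ : Measure S)) := by
  have := h.isProbabilityMeasure
  have := isProbabilityMeasure_sampleLaw (dirichletLaw (ε • (ϱ : Measure S))) N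
  set σ := sampleLaw (dirichletLaw (ε • (ϱ : Measure S))) N
  have hD := measurable_dirichletLaw_posterior h (N := N)
  have h1 : ∫⁻ ν, (Measure.pi fun _ : Fin N => (ν : Measure S)) A * g ν
      ∂dirichletLaw (ε • (ϱ : Measure S))
      = ∫⁻ x in A, ∫⁻ ν, g ν ∂dirichletLaw (posterior (ε • (ϱ : Measure S)) x) ∂σ := by
    have hf : Measurable fun p : (Fin N → S) × ProbabilityMeasure S => A.indicator 1 p.1 * g p.2 :=
      ((measurable_one.indicator hA).comp measurable_fst).mul (hg.comp measurable_snd)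
    have h2 := lintegral_dirichletLaw_pi h hf
    simp only at h2
    rw [← lintegral_indicator hA]
    convert h2 using 1
    · refine lintegral_congr fun ν => ?_
      rw [lintegral_mul_const _ (measurable_one.indicator hA), lintegral_indicator_one hA]
    · refine lintegral_congr fun x => ?_
      rw [lintegral_const_mul _ hg]
      by_cases hx : x ∈ A <;> simp [hx]
  rw [h1, freshLaw_eq, Measure.lintegral_bind hD.aemeasurable hg.aemeasurable,
    ProbabilityTheory.cond, lintegral_smul_measure, smul_eq_mul, ← mul_assoc]
  by_cases h0 : σ A = 0
  · simp [Measure.restrict_eq_zero.2 h0]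
  · rw [ENNReal.mul_inv_cancel h0 (measure_ne_top _ _), one_mul]

theorem freshLaw_univ_le
    (h : IsDirichletLaw (ε • (ϱ : Measure S)) (dirichletLaw (ε • (ϱ : Measure S)))) {N : ℕ}
    (ϱN : Measure (Fin N → S)) (A : Set (Fin N → S)) :
    freshLaw ε ϱ ϱN A Set.univ ≤ 1 := by
  rw [freshLaw_eq, Measure.bind_apply MeasurableSet.univ
    (measurable_dirichletLaw_posterior h).aemeasurable]
  have := fun x : Fin N → S => (h.posterior x).isProbabilityMeasure
  simp only [measure_univ, lintegral_one]
  rw [ProbabilityTheory.cond, Measure.smul_apply, Measure.restrict_apply_univ, smul_eq_mul]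
  exact ENNReal.inv_mul_le_one _

theorem rowWeights_last {N : ℕ} (ϱN : Measure (Fin N → S)) (A : Set (Fin N → S)) {m : ℕ}
    (v : Fin m → ProbabilityMeasure S) :
    rowWeights κ ϱN A v (Fin.last m) = κ * (ϱN A).toNNReal := by
  simp [rowWeights]

theorem rowWeights_castSucc {N : ℕ} (ϱN : Measure (Fin N → S)) (A : Set (Fin N → S)) {m : ℕ}
    (v : Fin m → ProbabilityMeasure S) (i : Fin m) :
    (rowWeights κ ϱN A v i.castSucc : ℝ≥0∞)
      = (Measure.pi fun _ : Fin N => (v i : Measure S)) A := by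
  simp only [rowWeights, Fin.snoc_castSucc]
  exact ProbabilityMeasure.ennreal_coeFn_eq_coeFn_toMeasure _ _

/-- Only an inequality, since the step law is zero if all row weights vanish and the fresh law is
zero if A is a null set. -/
theorem stepLaw_univ_le
    (h : IsDirichletLaw (ε • (ϱ : Measure S)) (dirichletLaw (ε • (ϱ : Measure S)))) {N : ℕ}
    (ϱN : Measure (Fin N → S)) (A : Set (Fin N → S)) {m : ℕ} (v : Fin m → ProbabilityMeasure S) :
    stepLaw κ ε ϱ ϱN A v Set.univ ≤ 1 := by
  rw [stepLaw]
  set t := rowWeights κ ϱN A v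
  have h1 : (t (Fin.last m) • freshLaw ε ϱ ϱN A
      + ∑ i : Fin m, t i.castSucc • Measure.dirac (v i)) Set.univ ≤ ((∑ i, t i : ℝ≥0) : ℝ≥0∞) := by
    rw [Fin.sum_univ_castSucc, add_comm, Measure.add_apply, Measure.finsetSum_apply]
    push_cast
    gcongr
    · simp [ENNReal.smul_def]
    · rw [Pi.smul_apply, ENNReal.smul_def, smul_eq_mul]
      exact mul_le_of_le_one_right' (freshLaw_univ_le h ϱN A)
  rw [Measure.smul_apply, ENNReal.smul_def, smul_eq_mul]
  refine (mul_le_mul_right h1 _).trans ?_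
  rw [← ENNReal.coe_mul]
  exact_mod_cast inv_mul_le_one

/-- The unnormalised step law is the urn measure reweighted by the likelihood z^N(A): its diffuse
part by `lintegral_freshLaw`, its atoms by evaluation. -/
theorem lintegral_stepLaw
    (h : IsDirichletLaw (ε • (ϱ : Measure S)) (dirichletLaw (ε • (ϱ : Measure S)))) {N : ℕ}
    {ϱN : Measure (Fin N → S)} (hϱN : ϱN = sampleLaw (dirichletLaw (ε • (ϱ : Measure S))) N)
    {A : Set (Fin N → S)} (hA : MeasurableSet A) {m : ℕ} (v : Fin m → ProbabilityMeasure S)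
    {g : ProbabilityMeasure S → ℝ≥0∞} (hg : Measurable g) :
    ((∑ i, rowWeights κ ϱN A v i : ℝ≥0) : ℝ≥0∞) * ∫⁻ z, g z ∂stepLaw κ ε ϱ ϱN A v
      = ∫⁻ z, (Measure.pi fun _ : Fin N => (z : Measure S)) A * g z
          ∂posterior (κ • dirichletLaw (ε • (ϱ : Measure S))) v := by
  have := h.isProbabilityMeasure
  have := isProbabilityMeasure_sampleLaw (dirichletLaw (ε • (ϱ : Measure S))) N
  have hm : Measurable fun z : ProbabilityMeasure S =>
    (Measure.pi fun _ : Fin N => (z : Measure S)) A * g z := (measurable_pi_apply_set hA).mul hg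
  set t := rowWeights κ ϱN A v with ht
  have hR : ∫⁻ z, (Measure.pi fun _ : Fin N => (z : Measure S)) A * g z
          ∂posterior (κ • dirichletLaw (ε • (ϱ : Measure S))) v
      = t (Fin.last m) * ∫⁻ z, g z ∂freshLaw ε ϱ ϱN A + ∑ i : Fin m, t i.castSucc * g (v i) := by
    rw [posterior, lintegral_add_measure, lintegral_smul_measure, lintegral_finsetSum_measure,
      ← lintegral_freshLaw h hA hg, ← hϱN, ht, rowWeights_last, ENNReal.coe_mul,
      ENNReal.coe_toNNReal (by rw [hϱN]; exact measure_ne_top _ _), ENNReal.smul_def, smul_eq_mul,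
      mul_assoc]
    congr 1
    refine Finset.sum_congr rfl fun i _ => ?_
    rw [lintegral_dirac' _ hm, rowWeights_castSucc]
  have hL : ∫⁻ z, g z ∂stepLaw κ ε ϱ ϱN A v = ((∑ i, t i)⁻¹ : ℝ≥0) *
      (t (Fin.last m) * ∫⁻ z, g z ∂freshLaw ε ϱ ϱN A + ∑ i : Fin m, t i.castSucc * g (v i)) := by
    rw [stepLaw, lintegral_smul_measure, lintegral_add_measure, lintegral_smul_measure,
      lintegral_finsetSum_measure, ENNReal.smul_def, ENNReal.smul_def, smul_eq_mul, smul_eq_mul]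
    congr 2
    refine Finset.sum_congr rfl fun i _ => ?_
    rw [lintegral_smul_measure, lintegral_dirac' _ hg, ENNReal.smul_def, smul_eq_mul]
  rw [hR, hL, ← mul_assoc, ← ENNReal.coe_mul]
  -- If the normalising sum is 0, its inverse is 0, but each weight vanishes too and both sides are
  -- 0.
  by_cases h0 : ∑ i, t i = 0
  · have h1 : ∀ i, t i = 0 := fun i => (Finset.sum_eq_zero_iff.1 h0) i (Finset.mem_univ i)
    simp [h1]
  · rw [mul_inv_cancel₀ h0, ENNReal.coe_one, one_mul]

theorem measurable_sum_rowWeights {N : ℕ} (ϱN : Measure (Fin N → S)) {A : Set (Fin N → S)}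
    (hA : MeasurableSet A) {m : ℕ} :
    Measurable fun v : Fin m → ProbabilityMeasure S => ∑ i, rowWeights κ ϱN A v i := by
  simp_rw [Fin.sum_univ_castSucc, rowWeights_last]
  refine (Finset.measurable_fun_sum _ fun i _ => ?_).add measurable_const
  have h1 : (fun v : Fin m → ProbabilityMeasure S => rowWeights κ ϱN A v i.castSucc)
      = fun v => ((Measure.pi fun _ : Fin N => (v i : Measure S)) A).toNNReal := by
    ext v
    rw [← rowWeights_castSucc (κ := κ) ϱN A v i, ENNReal.toNNReal_coe]
  rw [h1]
  exact ((measurable_pi_apply_set hA).comp (measurable_pi_apply i)).ennreal_toNNReal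

theorem measurable_totalWeight {M N : ℕ} (ϱN : Measure (Fin N → S)) {A : Fin M → Set (Fin N → S)}
    (hA : ∀ m, MeasurableSet (A m)) :
    Measurable (totalWeight κ ϱN A : (Fin M → ProbabilityMeasure S) → ℝ≥0) := by
  refine Finset.measurable_fun_prod _ fun m _ => ?_
  refine measurable_const.mul ((measurable_sum_rowWeights ϱN (hA m)).comp ?_)
  exact measurable_pi_lambda _ fun i => measurable_pi_apply _

theorem totalWeight_succ {M N : ℕ} (ϱN : Measure (Fin N → S)) (A : Fin (M + 1) → Set (Fin N → S))
    (u : Fin (M + 1) → ProbabilityMeasure S) :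
    totalWeight κ ϱN A u = totalWeight κ ϱN (Fin.init A) (Fin.init u)
      * ((κ + M)⁻¹ * ∑ i, rowWeights κ ϱN (A (Fin.last M)) (Fin.init u) i) := by
  rw [totalWeight, Fin.prod_univ_castSucc]
  rfl

/-- Importance sampling identity: the weighted law of a simulation. -/
theorem IsSimulation.lintegral_totalWeight_mul
    (h : IsDirichletLaw (ε • (ϱ : Measure S)) (dirichletLaw (ε • (ϱ : Measure S))))
    (hβ : IsDirichletLaw (κ • dirichletLaw (ε • (ϱ : Measure S)))
      (dirichletLaw (κ • dirichletLaw (ε • (ϱ : Measure S)))))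
    {N : ℕ} {ϱN : Measure (Fin N → S)}
    (hϱN : ϱN = sampleLaw (dirichletLaw (ε • (ϱ : Measure S))) N)
    {Ω' : Type*} [MeasurableSpace Ω'] {P' : Measure Ω'} [IsProbabilityMeasure P']
    {M : ℕ} {A : Fin M → Set (Fin N → S)} (hA : ∀ m, MeasurableSet (A m))
    {u : Ω' → Fin M → ProbabilityMeasure S} (hu : IsSimulation κ ε ϱ ϱN A u P')
    {g : (Fin M → ProbabilityMeasure S) → ℝ≥0∞} (hg : Measurable g) :
    ∫⁻ ω, totalWeight κ ϱN A (u ω) * g (u ω) ∂P'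
      = ∫⁻ v, (∏ m, (Measure.pi fun _ : Fin N => (v m : Measure S)) (A m)) * g v
          ∂sampleLaw (dirichletLaw (κ • dirichletLaw (ε • (ϱ : Measure S)))) M := by
  have := h.isProbabilityMeasure
  have := hβ.isProbabilityMeasure
  induction M with
  | zero =>
    have := isProbabilityMeasure_sampleLaw
      (dirichletLaw (κ • dirichletLaw (ε • (ϱ : Measure S)))) 0
    obtain ⟨c, hc⟩ : ∃ c, g = fun _ => c :=
      ⟨g finZeroElim, funext fun v => congrArg g (Subsingleton.elim _ _)⟩
    rw [hc]
    simp only [totalWeight, Finset.univ_eq_empty, Finset.prod_empty, ENNReal.coe_one, one_mul,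
      lintegral_const, measure_univ]
  | succ M ih =>
    set β := κ • dirichletLaw (ε • (ϱ : Measure S)) with hβdef
    have hβu : β Set.univ + M = ((κ + M : ℝ≥0) : ℝ≥0∞) := by
      rw [hβdef, Measure.smul_apply, measure_univ, ENNReal.smul_def, smul_eq_mul, mul_one]
      push_cast
      rfl
    have hβfin := hβ.finite
    have hc := ne_zero_and_ne_top hβ M
    have hc0 : (κ + M : ℝ≥0) ≠ 0 := by
      have := hc.1
      rw [hβu] at this
      exact_mod_cast this
    set T : (Fin M → ProbabilityMeasure S) → ℝ≥0 := fun v =>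
      ∑ i, rowWeights κ ϱN (A (Fin.last M)) v i with hT
    have hTm : Measurable T := measurable_sum_rowWeights ϱN (hA _)
    have hWm : Measurable (totalWeight κ ϱN (Fin.init A) :
      (Fin M → ProbabilityMeasure S) → ℝ≥0) := measurable_totalWeight ϱN fun m => hA _
    have hgs : Measurable fun p : (Fin M → ProbabilityMeasure S) × ProbabilityMeasure S =>
      g (Fin.snoc p.1 p.2) := hg.comp measurable_snoc
    have hlast := hu (Fin.last M)
    have hinit : IsSimulation κ ε ϱ ϱN (Fin.init A) (fun ω => Fin.init (u ω)) P' :=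
      fun m => hu m.castSucc
    -- condition on the first `M` rows
    have h1 : ∫⁻ ω, totalWeight κ ϱN A (u ω) * g (u ω) ∂P'
        = ∫⁻ ω, totalWeight κ ϱN (Fin.init A) (Fin.init (u ω)) * (((κ + M)⁻¹ : ℝ≥0) *
          ∫⁻ z, (Measure.pi fun _ : Fin N => (z : Measure S)) (A (Fin.last M))
            * g (Fin.snoc (Fin.init (u ω)) z) ∂posterior β (Fin.init (u ω))) ∂P' := by
      have hF : Measurable fun p : (Fin M → ProbabilityMeasure S) × ProbabilityMeasure S =>
          ((totalWeight κ ϱN (Fin.init A) p.1 * ((κ + M)⁻¹ * T p.1) : ℝ≥0) : ℝ≥0∞)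
            * g (Fin.snoc p.1 p.2) :=
        ((hWm.comp measurable_fst).mul ((hTm.comp measurable_fst).const_mul _)
          ).coe_nnreal_ennreal.mul hgs
      have h2 := hlast.lintegral_eq (fun v => stepLaw_univ_le h ϱN _ v) hF
      have h3 : ∀ ω, ((totalWeight κ ϱN A (u ω) : ℝ≥0) : ℝ≥0∞) * g (u ω)
          = ((totalWeight κ ϱN (Fin.init A) (Fin.init (u ω)) * ((κ + M)⁻¹ * T (Fin.init (u ω))) :
            ℝ≥0) : ℝ≥0∞) * g (Fin.snoc (Fin.init (u ω)) (u ω (Fin.last M))) := fun ω => by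
        rw [totalWeight_succ, Fin.snoc_init_self]
      simp_rw [h3]
      refine h2.trans (lintegral_congr fun ω => ?_)
      change ∫⁻ z, ((totalWeight κ ϱN (Fin.init A) (Fin.init (u ω)) *
        ((κ + M)⁻¹ * T (Fin.init (u ω))) : ℝ≥0) : ℝ≥0∞) * g (Fin.snoc (Fin.init (u ω)) z)
        ∂stepLaw κ ε ϱ ϱN (A (Fin.last M)) (Fin.init (u ω)) = _
      have hgz : Measurable fun z => g (Fin.snoc (Fin.init (u ω)) z) :=
        hgs.comp measurable_prodMk_left
      rw [lintegral_const_mul _ hgz, ← lintegral_stepLaw h hϱN (hA _) _ hgz]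
      push_cast
      simp only [hT]
      push_cast
      ring
    have hpm : Measurable fun p : (Fin M → ProbabilityMeasure S) × ProbabilityMeasure S =>
        (Measure.pi fun _ : Fin N => (p.2 : Measure S)) (A (Fin.last M)) * g (Fin.snoc p.1 p.2) :=
      ((measurable_pi_apply_set (hA _)).comp measurable_snd).mul hgs
    have hI : Measurable fun v : Fin M → ProbabilityMeasure S =>
        ∫⁻ z, (Measure.pi fun _ : Fin N => (z : Measure S)) (A (Fin.last M))
            * g (Fin.snoc v z) ∂posterior β v :=
      measurable_lintegral_of_le measurable_posterior hc.2 (fun v => (posterior_univ v).le) hpm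
    have hprod : Measurable fun v : Fin (M + 1) → ProbabilityMeasure S =>
        (∏ m, (Measure.pi fun _ : Fin N => (v m : Measure S)) (A m)) * g v :=
      (Finset.measurable_fun_prod _ fun m _ =>
        (measurable_pi_apply_set (hA m)).comp (measurable_pi_apply m)).mul hg
    have hprod' : Measurable fun v : Fin M → ProbabilityMeasure S =>
        ∏ m, (Measure.pi fun _ : Fin N => (v m : Measure S)) (Fin.init A m) :=
      Finset.measurable_fun_prod _ fun m _ =>
        (measurable_pi_apply_set (hA _)).comp (measurable_pi_apply m)
    have hW : Measurable fun v : Fin M → ProbabilityMeasure S =>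
        (∏ m, (Measure.pi fun _ : Fin N => (v m : Measure S)) (Fin.init A m)) *
          ((((κ + M)⁻¹ : ℝ≥0) : ℝ≥0∞) *
            ∫⁻ z, (Measure.pi fun _ : Fin N => (z : Measure S)) (A (Fin.last M))
              * g (Fin.snoc v z) ∂posterior β v) := hprod'.mul (hI.const_mul _)
    -- Multiplying by β(univ) + M = κ + M prepares for the urn recursion on the right; on the left
    -- it cancels the factor (κ + M)⁻¹ in the last term of the total weight.
    rw [h1, ih (A := Fin.init A) (fun m => hA _) hinit (hI.const_mul _), ← ENNReal.mul_right_inj hc.1 hc.2,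
      lintegral_sampleLaw_succ hβ hprod, ← lintegral_const_mul _ hW]
    refine lintegral_congr fun v => ?_
    have h4 : ∀ z, (∏ m, (Measure.pi fun _ : Fin N =>
        ((Fin.snoc v z : Fin (M + 1) → ProbabilityMeasure S) m : Measure S)) (A m))
          * g (Fin.snoc v z)
        = (∏ m, (Measure.pi fun _ : Fin N => (v m : Measure S)) (Fin.init A m)) *
          ((Measure.pi fun _ : Fin N => (z : Measure S)) (A (Fin.last M)) * g (Fin.snoc v z)) := by
      intro z
      rw [Fin.prod_univ_castSucc]
      simp only [Fin.snoc_castSucc, Fin.snoc_last, Fin.init]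
      ring
    simp_rw [h4]
    have hpv : Measurable fun z : ProbabilityMeasure S =>
        (Measure.pi fun _ : Fin N => (z : Measure S)) (A (Fin.last M)) * g (Fin.snoc v z) :=
      hpm.comp measurable_prodMk_left
    rw [lintegral_const_mul _ hpv, hβu, mul_left_comm]
    congr 1
    rw [← mul_assoc, ← ENNReal.coe_mul, mul_inv_cancel₀ hc0, ENNReal.coe_one, one_mul]

/-- Every row contributes at least the weight κϱ_N(A_m) of a fresh draw, so no simulation has weight
zero. -/
theorem totalWeight_pos (hκ : 0 < κ) {M N : ℕ} {ϱN : Measure (Fin N → S)} [IsFiniteMeasure ϱN]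
    {A : Fin M → Set (Fin N → S)} (hA : ∀ m, ϱN (A m) ≠ 0)
    (u : Fin M → ProbabilityMeasure S) : 0 < totalWeight κ ϱN A u := by
  refine Finset.prod_pos fun m _ => mul_pos (by positivity) ?_
  rw [Fin.sum_univ_castSucc, rowWeights_last]
  have : 0 < (ϱN (A m)).toNNReal := ENNReal.toNNReal_pos (hA m) (measure_ne_top _ _)
  positivity

end Simulation

/-! ### Block frequencies within a row -/

section Blocks

variable {S : Type*}

/-- The relative frequency of the event `A` among the first `K` blocks of length `N`. -/
noncomputable def blockFreq {N : ℕ} (A : Set (Fin N → S)) (K : ℕ) (x : ℕ → S) : ℝ :=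
  (∑ k ∈ Finset.range K, A.indicator (1 : (Fin N → S) → ℝ) fun j => x (k * N + j)) / K

theorem blockFreq_nonneg {N : ℕ} (A : Set (Fin N → S)) (K : ℕ) (x : ℕ → S) :
    0 ≤ blockFreq A K x :=
  div_nonneg (Finset.sum_nonneg fun _ _ => Set.indicator_nonneg (fun _ _ => zero_le_one) _)
    (Nat.cast_nonneg _)

theorem blockFreq_le_one {N : ℕ} (A : Set (Fin N → S)) (K : ℕ) (x : ℕ → S) :
    blockFreq A K x ≤ 1 := by
  refine div_le_one_of_le₀ ?_ (Nat.cast_nonneg _)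
  calc _ ≤ ∑ k ∈ Finset.range K, (1 : ℝ) :=
        Finset.sum_le_sum fun k _ => Set.indicator_le_self' (fun _ _ => zero_le_one) _
    _ = K := by simp

theorem injective_block (N k : ℕ) : Function.Injective fun j : Fin N => k * N + (j : ℕ) :=
  fun i j hij => Fin.ext (by simpa using hij)

/-- The permutation of `ℕ` that swaps the blocks of length `N` starting at `0` and at `c`. -/
def blockSwap (N c : ℕ) (h : c = 0 ∨ N ≤ c) : Equiv.Perm ℕ :=
  Function.Involutive.toPerm
    (fun n => if n < N then c + n else if c ≤ n ∧ n < c + N then n - c else n) (by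
      intro n
      dsimp only
      split_ifs <;> omega)

theorem blockSwap_apply_lt {N c : ℕ} (h : c = 0 ∨ N ≤ c) {n : ℕ} (hn : n < N) :
    blockSwap N c h n = c + n := if_pos hn

theorem blockSwap_mem_range {N c : ℕ} (h : c = 0 ∨ N ≤ c) {K : ℕ} (hK : c + N ≤ K) {n : ℕ}
    (hn : n < K) : blockSwap N c h n < K := by
  change (if n < N then c + n else if c ≤ n ∧ n < c + N then n - c else n) < K
  split_ifs <;> omega

/-- The upper asymptotic frequencies of the cells of a partition. -/
noncomputable def cellFreq {d : ℕ} (p : S → Fin (d + 1)) (x : ℕ → S) : Fin (d + 1) → ℝ :=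
  fun l => limsup (fun K => blockFreq {v : Fin 1 → S | p (v 0) = l} K x) atTop

/-- Once K ≥ c + N, the swap permutes the first K indices, so frequencies are eventually unchanged.
Defining the frequency as an upper limit makes this invariance hold for every sequence, not just
almost surely. -/
theorem cellFreq_comp_blockSwap {d : ℕ} (p : S → Fin (d + 1)) {N c : ℕ} (h : c = 0 ∨ N ≤ c)
    (x : ℕ → S) : cellFreq p (fun n => x (blockSwap N c h n)) = cellFreq p x := by
  ext l
  refine limsup_congr ?_
  filter_upwards [eventually_ge_atTop (c + N)] with K hK
  rw [blockFreq, blockFreq]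
  congr 1
  refine Finset.sum_bij' (fun k _ => blockSwap N c h k) (fun k _ => (blockSwap N c h).symm k)
    ?_ ?_ ?_ ?_ ?_
  · intro k hk
    exact Finset.mem_range.2 (blockSwap_mem_range h hK (Finset.mem_range.1 hk))
  · intro k hk
    exact Finset.mem_range.2 (blockSwap_mem_range h hK (Finset.mem_range.1 hk))
  · simp
  · simp
  · intro k _
    simp [Set.indicator_apply]

variable [MeasurableSpace S]

instance isProbabilityMeasure_iidLaw (ν : ProbabilityMeasure S) :
    IsProbabilityMeasure (iidLaw ν) := by
  unfold iidLaw; infer_instance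

theorem iidLaw_map {N : ℕ} (ν : ProbabilityMeasure S) {e : Fin N → ℕ}
    (he : Function.Injective e) :
    (iidLaw ν).map (fun x j => x (e j)) = Measure.pi fun _ => (ν : Measure S) := by
  rw [iidLaw, Measure.map_infinitePi_infinitePi_of_inj he, Measure.infinitePi_eq_pi]

theorem HasCondLaw.ae_mem {Ω X Y : Type*} [MeasurableSpace Ω] [MeasurableSpace X]
    [MeasurableSpace Y] {P : Measure Ω} [IsProbabilityMeasure P] {U : Ω → Y} {W : Ω → X}
    {k : X → Measure Y} (h : HasCondLaw U W k P) (hk : ∀ x, k x Set.univ ≤ 1)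
    {G : Set (X × Y)} (hG : MeasurableSet G) (hGk : ∀ x, ∀ᵐ y ∂k x, (x, y) ∈ G) :
    ∀ᵐ ω ∂P, (W ω, U ω) ∈ G := by
  have hm : Measurable (Gᶜ.indicator (1 : X × Y → ℝ≥0∞)) := measurable_one.indicator hG.compl
  have h1 := h.lintegral_eq hk hm
  have h2 : ∀ ω, ∫⁻ y, Gᶜ.indicator (1 : X × Y → ℝ≥0∞) (W ω, y) ∂k (W ω) = 0 := fun ω => by
    have hy : Measurable fun y => Gᶜ.indicator (1 : X × Y → ℝ≥0∞) (W ω, y) :=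
      hm.comp measurable_prodMk_left
    rw [lintegral_eq_zero_iff hy]
    filter_upwards [hGk (W ω)] with y hy
    simp [hy]
  simp only [h2, lintegral_zero] at h1
  have hω : Measurable fun ω => Gᶜ.indicator (1 : X × Y → ℝ≥0∞) (W ω, U ω) :=
    hm.comp (h.measurable_right.prodMk h.measurable_left)
  rw [lintegral_eq_zero_iff hω] at h1
  filter_upwards [h1] with ω hω
  by_contra hn
  simp [hn] at hω

theorem measurable_blockFreq {N : ℕ} {A : Set (Fin N → S)} (hA : MeasurableSet A) (K : ℕ) :
    Measurable (blockFreq A K) := by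
  refine (Finset.measurable_fun_sum _ fun k _ => ?_).div_const _
  exact (measurable_one.indicator hA).comp (measurable_pi_lambda _ fun j => measurable_pi_apply _)

/-- The strong law for block indicators: disjoint blocks are independent and each has law ν^N. -/
theorem tendsto_blockFreq_iidLaw {N : ℕ} {A : Set (Fin N → S)} (hA : MeasurableSet A)
    (ν : ProbabilityMeasure S) :
    ∀ᵐ x ∂iidLaw ν, Tendsto (fun K => blockFreq A K x) atTop
      (𝓝 ((Measure.pi fun _ : Fin N => (ν : Measure S)).real A)) := by
  let X : ℕ → (ℕ → S) → ℝ := fun k x => A.indicator 1 fun j : Fin N => x (k * N + j)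
  have hAm : Measurable (A.indicator (1 : (Fin N → S) → ℝ)) := measurable_one.indicator hA
  have hb : ∀ k, Measurable fun (x : ℕ → S) (j : Fin N) => x (k * N + j) := fun k =>
    measurable_pi_lambda _ fun j => measurable_pi_apply _
  have hX : ∀ k, Measurable (X k) := fun k => hAm.comp (hb k)
  have hlaw : ∀ k, (iidLaw ν).map (fun (x : ℕ → S) (j : Fin N) => x (k * N + j))
      = Measure.pi fun _ => (ν : Measure S) := fun k => iidLaw_map ν (injective_block N k)
  have hint : Integrable (X 0) (iidLaw ν) :=
    Integrable.of_bound (hX 0).aestronglyMeasurable 1 (ae_of_all _ fun x => by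
      simp only [X]
      refine (norm_indicator_le_norm_self _ _).trans (by simp))
  have hind : Pairwise fun k l => IndepFun (X k) (X l) (iidLaw ν) := by
    intro k l hkl
    have h0 : iIndepFun (fun (i : ℕ) (x : ℕ → S) => x i) (iidLaw ν) :=
      iIndepFun_infinitePi (X := fun _ ω => ω) (by fun_prop)
    let s : ℕ → Finset ℕ := fun k => Finset.univ.image fun j : Fin N => k * N + (j : ℕ)
    have hs : ∀ k (j : Fin N), k * N + (j : ℕ) ∈ s k := fun k j =>
      Finset.mem_image_of_mem _ (Finset.mem_univ j)
    have hd : Disjoint (s k) (s l) := by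
      rw [Finset.disjoint_left]
      intro n hn hn'
      obtain ⟨i, -, hi⟩ := Finset.mem_image.1 hn
      obtain ⟨j, -, hj⟩ := Finset.mem_image.1 hn'
      apply hkl
      have hN : 0 < N := i.pos
      have h1 : n / N = k := by
        rw [← hi, mul_comm, Nat.mul_add_div hN, Nat.div_eq_of_lt i.2, add_zero]
      have h2 : n / N = l := by
        rw [← hj, mul_comm, Nat.mul_add_div hN, Nat.div_eq_of_lt j.2, add_zero]
      rw [← h1, h2]
    have h1 := h0.indepFun_finset (s k) (s l) hd fun i => measurable_pi_apply i
    exact h1.comp (φ := fun z => A.indicator 1 fun j : Fin N => z ⟨k * N + j, hs k j⟩)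
      (ψ := fun z => A.indicator 1 fun j : Fin N => z ⟨l * N + j, hs l j⟩)
      (hAm.comp (measurable_pi_lambda _ fun j => measurable_pi_apply _))
      (hAm.comp (measurable_pi_lambda _ fun j => measurable_pi_apply _))
  have hid : ∀ k, IdentDistrib (X k) (X 0) (iidLaw ν) (iidLaw ν) := fun k =>
    (IdentDistrib.mk (hb k).aemeasurable (hb 0).aemeasurable (by rw [hlaw, hlaw])).comp hAm
  have hE : ∫ x, X 0 x ∂iidLaw ν = (Measure.pi fun _ : Fin N => (ν : Measure S)).real A := by
    have h1 := integral_map (μ := iidLaw ν) (hb 0).aemeasurable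
      (f := A.indicator (1 : (Fin N → S) → ℝ)) hAm.aestronglyMeasurable
    rw [hlaw, integral_indicator_one hA] at h1
    exact h1.symm
  have := strong_law_ae_real X hint hind hid
  rw [hE] at this
  exact this

theorem HasCondLaw.tendsto_blockFreq {Ω : Type*} [MeasurableSpace Ω] {P : Measure Ω}
    [IsProbabilityMeasure P] {μ : Ω → ProbabilityMeasure S} {x : Ω → ℕ → S}
    (h : HasCondLaw x μ iidLaw P) {N : ℕ} {A : Set (Fin N → S)} (hA : MeasurableSet A) :
    ∀ᵐ ω ∂P, Tendsto (fun K => blockFreq A K (x ω)) atTop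
      (𝓝 ((Measure.pi fun _ : Fin N => (μ ω : Measure S)).real A)) := by
  refine h.ae_mem (fun ν => measure_univ.le)
    (G := {p : ProbabilityMeasure S × (ℕ → S) | Tendsto (fun K => blockFreq A K p.2) atTop
      (𝓝 ((Measure.pi fun _ : Fin N => (p.1 : Measure S)).real A))}) ?_
    fun ν => tendsto_blockFreq_iidLaw hA ν
  exact measurableSet_tendsto_fun (fun K => (measurable_blockFreq hA K).comp measurable_snd)
    ((measurable_pi_apply_set hA).comp measurable_fst).ennreal_toReal

theorem measurableSet_cell {d : ℕ} {p : S → Fin (d + 1)} (hp : Measurable p) (l : Fin (d + 1)) :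
    MeasurableSet {v : Fin 1 → S | p (v 0) = l} :=
  (hp.comp (measurable_pi_apply 0)) (measurableSet_singleton l)

theorem measurable_cellFreq {d : ℕ} {p : S → Fin (d + 1)} (hp : Measurable p) :
    Measurable (cellFreq p) :=
  measurable_pi_lambda _ fun l =>
    Measurable.limsup fun K => measurable_blockFreq (measurableSet_cell hp l) K

theorem pi_real_cell {d : ℕ} {p : S → Fin (d + 1)} (hp : Measurable p) (l : Fin (d + 1))
    (ν : ProbabilityMeasure S) :
    (Measure.pi fun _ : Fin 1 => (ν : Measure S)).real {v | p (v 0) = l} = cells p ν l := by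
  rw [cells, measureReal_def, measureReal_def]
  congr 1
  exact (measurePreserving_eval (fun _ : Fin 1 => (ν : Measure S)) 0).measure_preimage
    (hp (measurableSet_singleton l)).nullMeasurableSet

/-- Recovers the cell probabilities of the random row distribution from the row itself, so that
functions of μ can be handled by exchangeability of ξ alone. -/
theorem HasCondLaw.cellFreq_eq {Ω : Type*} [MeasurableSpace Ω] {P : Measure Ω}
    [IsProbabilityMeasure P] {μ : Ω → ProbabilityMeasure S} {x : Ω → ℕ → S}
    (h : HasCondLaw x μ iidLaw P) {d : ℕ} {p : S → Fin (d + 1)} (hp : Measurable p) :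
    ∀ᵐ ω ∂P, cellFreq p (x ω) = cells p (μ ω) := by
  have h1 := ae_all_iff.2 fun l => h.tendsto_blockFreq (measurableSet_cell hp l)
  filter_upwards [h1] with ω hω
  ext l
  rw [cellFreq, (hω l).limsup_eq, pi_real_cell hp]

end Blocks

/-! ### The array: laws of rows and conditional independence -/

section Array

variable {Ω S : Type*} [MeasurableSpace Ω] [MeasurableSpace S] {P : Measure Ω}
  {κ ε : ℝ≥0} {ϱ : ProbabilityMeasure S}
  {ϖ : Ω → ProbabilityMeasure (ProbabilityMeasure S)}
  {μ : ℕ → Ω → ProbabilityMeasure S} {ξ : ℕ → ℕ → Ω → S}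

theorem measurable_rows (hμ : HasCondLaw (fun ω i => μ i ω) ϖ iidLaw P) (i : ℕ) :
    Measurable (μ i) :=
  (measurable_pi_apply i).comp hμ.measurable_left

theorem measurable_rowData (hξ : ∀ i, HasCondLaw (fun ω j => ξ i j ω) (μ i) iidLaw P) (N i : ℕ) :
    Measurable (rowData ξ N i) :=
  measurable_pi_lambda _ fun j => (measurable_pi_apply (j : ℕ)).comp (hξ i).measurable_left

/-- Permutations may be chosen row by row, so each row can bring its own block k m to the front,
while the factors G m do not notice the swap. -/
theorem RowExchangeable.integral_blocks (hex : RowExchangeable ξ P)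
    {M N : ℕ} {A : Fin M → Set (Fin N → S)} (hA : ∀ m, MeasurableSet (A m))
    {G : Fin M → (ℕ → S) → ℝ} (hG : ∀ m, Measurable (G m))
    (hGs : ∀ m c (h : c = 0 ∨ N ≤ c) x, G m (fun n => x (blockSwap N c h n)) = G m x)
    (k : Fin M → ℕ) :
    ∫ ω, (∏ m, (A m).indicator (1 : (Fin N → S) → ℝ) fun j => ξ m (k m * N + j) ω)
        * ∏ m, G m (fun n => ξ m n ω) ∂P
      = ∫ ω, (∏ m, (A m).indicator (1 : (Fin N → S) → ℝ) (rowData ξ N m ω))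
        * ∏ m, G m (fun n => ξ m n ω) ∂P := by
  have hc : ∀ i : Fin M, k i * N = 0 ∨ N ≤ k i * N := fun i => by
    rcases Nat.eq_zero_or_pos (k i) with h | h
    · exact Or.inl (by simp [h])
    · exact Or.inr (Nat.le_mul_of_pos_left N h)
  -- Rows beyond the first M do not enter the integrand and are left fixed.
  let τ : ℕ → Equiv.Perm ℕ := fun i =>
    if h : i < M then blockSwap N (k ⟨i, h⟩ * N) (hc ⟨i, h⟩) else 1
  have hτ : ∀ m : Fin M, τ m = blockSwap N (k m * N) (hc m) := fun m => by simp [τ]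
  let H : (ℕ × ℕ → S) → ℝ := fun a =>
    (∏ m : Fin M, (A m).indicator (1 : (Fin N → S) → ℝ) fun j => a (m, j))
      * ∏ m : Fin M, G m fun n => a (m, n)
  have hH : Measurable H := by
    refine (Finset.measurable_fun_prod _ fun m _ => ?_).mul
      (Finset.measurable_fun_prod _ fun m _ => ?_)
    · exact (measurable_one.indicator (hA m)).comp
        (measurable_pi_lambda _ fun j => measurable_pi_apply _)
    · exact (hG m).comp (measurable_pi_lambda _ fun j => measurable_pi_apply _)
  have h1 := ((hex 1 τ).comp hH).integral_eq
  refine Eq.trans (integral_congr_ae (ae_of_all _ fun ω => ?_)) h1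
  simp only [Function.comp_apply, H, Equiv.Perm.one_apply, hτ]
  congr 1
  swap
  · exact Finset.prod_congr rfl fun m _ => (hGs m _ (hc m) fun n => ξ m n ω).symm
  refine Finset.prod_congr rfl fun m _ => ?_
  congr 1
  ext j
  rw [blockSwap_apply_lt _ j.2]

variable [IsProbabilityMeasure P]

/-- The default value 0 of `dirichletLaw` is excluded because the law of ϖ is a probability measure;
existence of the process is thus part of the hypothesis on ϖ. -/
theorem isDirichletLaw_generator (hϖ : HasLaw ϖ (dirichletLaw
    (κ • dirichletLaw (ε • (ϱ : Measure S)))) P) :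
    IsDirichletLaw (κ • dirichletLaw (ε • (ϱ : Measure S)))
      (dirichletLaw (κ • dirichletLaw (ε • (ϱ : Measure S)))) := by
  refine isDirichletLaw_of_ne_zero ?_
  rw [← hϖ.map_eq]
  have := Measure.isProbabilityMeasure_map hϖ.aemeasurable
  exact IsProbabilityMeasure.ne_zero _

/-- If the inner law had the default value 0, the outer parameter would be zero, which a Dirichlet
law does not allow. -/
theorem isDirichletLaw_base (hϖ : HasLaw ϖ (dirichletLaw
    (κ • dirichletLaw (ε • (ϱ : Measure S)))) P) :
    IsDirichletLaw (ε • (ϱ : Measure S)) (dirichletLaw (ε • (ϱ : Measure S))) := by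
  refine isDirichletLaw_of_ne_zero fun h0 => (isDirichletLaw_generator hϖ).ne_zero ?_
  rw [h0, smul_zero]

theorem lintegral_rows (hμ : HasCondLaw (fun ω i => μ i ω) ϖ iidLaw P)
    {Q : Measure (ProbabilityMeasure (ProbabilityMeasure S))} (hϖ : HasLaw ϖ Q P)
    {M : ℕ} {e : Fin M → ℕ} (he : Function.Injective e)
    {g : (Fin M → ProbabilityMeasure S) → ℝ≥0∞} (hg : Measurable g) :
    ∫⁻ ω, g (fun m => μ (e m) ω) ∂P = ∫⁻ v, g v ∂sampleLaw Q M := by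
  have he' : Measurable fun (x : ℕ → ProbabilityMeasure S) (m : Fin M) => x (e m) :=
    measurable_pi_lambda _ fun _ => measurable_pi_apply _
  have h1 := hμ.lintegral_eq (fun ν => measure_univ.le) (f := fun p => g fun m => p.2 (e m))
    (hg.comp (he'.comp measurable_snd))
  have h2 : ∀ ν : ProbabilityMeasure (ProbabilityMeasure S),
      ∫⁻ x, g (fun m => x (e m)) ∂iidLaw ν
        = ∫⁻ v, g v ∂(Measure.pi fun _ => (ν : Measure (ProbabilityMeasure S))) := fun ν => by
    rw [← iidLaw_map ν he, lintegral_map hg he']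
  simp only [h2] at h1
  rw [h1, lintegral_sampleLaw _ hg, ← hϖ.map_eq, lintegral_map _ hμ.measurable_right]
  exact measurable_lintegral_of_le (f := fun p => g p.2) (measurable_pi_measure M)
    ENNReal.one_ne_top (fun ν => by simp) (hg.comp measurable_snd)

/-- The first draw of the urn has the normalised base measure as its law; here κ cancels. -/
theorem lintegral_row (hκ : 0 < κ) (hμ : HasCondLaw (fun ω i => μ i ω) ϖ iidLaw P)
    (hϖ : HasLaw ϖ (dirichletLaw (κ • dirichletLaw (ε • (ϱ : Measure S)))) P) (i : ℕ)
    {g : ProbabilityMeasure S → ℝ≥0∞} (hg : Measurable g) :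
    ∫⁻ ω, g (μ i ω) ∂P = ∫⁻ ν, g ν ∂dirichletLaw (ε • (ϱ : Measure S)) := by
  have hβ := isDirichletLaw_generator hϖ
  have h0 := (isDirichletLaw_base hϖ).isProbabilityMeasure
  have h1 := lintegral_rows hμ hϖ (e := fun _ : Fin 1 => i) (Function.injective_of_subsingleton _)
    (g := fun v => g (v 0)) (hg.comp (measurable_pi_apply 0))
  have h2 := lintegral_sampleLaw_succ hβ (N := 0) (g := fun v => g (v 0))
    (hg.comp (measurable_pi_apply 0))
  have h3 : ∀ x : Fin 0 → ProbabilityMeasure S,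
      posterior (κ • dirichletLaw (ε • (ϱ : Measure S))) x
        = κ • dirichletLaw (ε • (ϱ : Measure S)) := fun x => by simp [posterior]
  have h4 : ∀ (x : Fin 0 → ProbabilityMeasure S) z,
      (Fin.snoc x z : Fin 1 → ProbabilityMeasure S) 0 = z := fun x z => by simp [Fin.snoc]
  have := hβ.isProbabilityMeasure
  have := isProbabilityMeasure_sampleLaw
    (dirichletLaw (κ • dirichletLaw (ε • (ϱ : Measure S)))) 0
  simp only [h3, h4, lintegral_const, measure_univ, mul_one, lintegral_smul_measure,
    Measure.smul_apply, Nat.cast_zero, add_zero] at h2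
  have h5 : ∀ z : ℝ≥0∞, κ • z = κ * z := fun _ => rfl
  rw [h5, h5, mul_one] at h2
  exact h1.trans ((ENNReal.mul_right_inj (by exact_mod_cast hκ.ne') ENNReal.coe_ne_top).1 h2)

theorem map_rowData (hκ : 0 < κ) (hμ : HasCondLaw (fun ω i => μ i ω) ϖ iidLaw P)
    (hξ : ∀ i, HasCondLaw (fun ω j => ξ i j ω) (μ i) iidLaw P)
    (hϖ : HasLaw ϖ (dirichletLaw (κ • dirichletLaw (ε • (ϱ : Measure S)))) P) (N i : ℕ) :
    P.map (rowData ξ N i) = sampleLaw (dirichletLaw (ε • (ϱ : Measure S))) N := by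
  ext B hB
  have hr : Measurable fun (x : ℕ → S) (j : Fin N) => x j :=
    measurable_pi_lambda _ fun _ => measurable_pi_apply _
  have h1 := (hξ i).lintegral_eq (fun ν => measure_univ.le)
    (f := fun p => B.indicator 1 fun j : Fin N => p.2 j)
    ((measurable_one.indicator hB).comp (hr.comp measurable_snd))
  have h2 : ∀ ν : ProbabilityMeasure S, ∫⁻ x, B.indicator 1 (fun j : Fin N => x j) ∂iidLaw ν
      = (Measure.pi fun _ : Fin N => (ν : Measure S)) B := fun ν => by
    rw [← iidLaw_map ν Fin.val_injective, ← lintegral_indicator_one hB,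
      lintegral_map (measurable_one.indicator hB) hr]
  simp only [h2] at h1
  rw [sampleLaw, Measure.bind_apply hB (measurable_pi_measure N).aemeasurable,
    ← lintegral_row hκ hμ hϖ i (measurable_pi_apply_set hB), ← h1, ← lintegral_indicator_one hB,
    lintegral_map (measurable_one.indicator hB) (measurable_rowData hξ N i)]
  rfl

/-- The left side is unchanged when the indicators are replaced by frequencies over K blocks, and
these converge to μ_m^N(A_m) almost surely. The factors G m, invariant under block swaps, carry the
information on the row distributions through the argument. -/
theorem IsNDPArray.integral_obs (h : IsNDPArray κ ε ϱ ϖ μ ξ P)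
    {M N : ℕ} {A : Fin M → Set (Fin N → S)} (hA : ∀ m, MeasurableSet (A m))
    {G : Fin M → (ℕ → S) → ℝ} (hG : ∀ m, Measurable (G m)) (hG0 : ∀ m x, ‖G m x‖ ≤ 1)
    (hGs : ∀ m c (h : c = 0 ∨ N ≤ c) x, G m (fun n => x (blockSwap N c h n)) = G m x) :
    ∫ ω, (∏ m, (A m).indicator (1 : (Fin N → S) → ℝ) (rowData ξ N m ω))
        * ∏ m, G m (fun n => ξ m n ω) ∂P
      = ∫ ω, (∏ m : Fin M, (Measure.pi fun _ : Fin N => (μ m ω : Measure S)).real (A m))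
        * ∏ m, G m (fun n => ξ m n ω) ∂P := by
  set J := ∫ ω, (∏ m, (A m).indicator (1 : (Fin N → S) → ℝ) (rowData ξ N m ω))
        * ∏ m, G m (fun n => ξ m n ω) ∂P
  have hrow : ∀ i, Measurable fun ω n => ξ i n ω := fun i => (h.entries i).measurable_left
  have hGm : Measurable fun ω => ∏ m : Fin M, G m (fun n => ξ m n ω) :=
    Finset.measurable_fun_prod _ fun m _ => (hG m).comp (hrow m)
  have hGb : ∀ ω, ‖∏ m : Fin M, G m (fun n => ξ m n ω)‖ ≤ 1 := fun ω => by
    rw [norm_prod]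
    exact Finset.prod_le_one (fun _ _ => norm_nonneg _) fun m _ => hG0 m _
  have hXm : ∀ (m : Fin M) (k : ℕ),
      Measurable fun ω => (A m).indicator (1 : (Fin N → S) → ℝ) fun j => ξ m (k * N + j) ω :=
    fun m k => (measurable_one.indicator (hA m)).comp
      (measurable_pi_lambda _ fun j => (measurable_pi_apply _).comp (hrow m))
  -- The product of M averages expands into K^M terms, one for each choice of a block per row, and
  -- all of them have the same integral.
  have hconst : ∀ K : ℕ, 0 < K → ∫ ω, (∏ m : Fin M, blockFreq (A m) K (fun n => ξ m n ω))
      * ∏ m, G m (fun n => ξ m n ω) ∂P = J := by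
    intro K hK
    have h1 : ∀ ω, (∏ m : Fin M, blockFreq (A m) K (fun n => ξ m n ω))
        * ∏ m, G m (fun n => ξ m n ω)
        = ((K : ℝ) ^ M)⁻¹ * ∑ k ∈ Fintype.piFinset fun _ : Fin M => Finset.range K,
          (∏ m, (A m).indicator (1 : (Fin N → S) → ℝ) fun j => ξ m (k m * N + j) ω)
            * ∏ m, G m (fun n => ξ m n ω) := by
      intro ω
      rw [← Finset.sum_mul, ← mul_assoc]
      congr 1
      simp only [blockFreq]
      rw [Finset.prod_div_distrib, Finset.prod_univ_sum, Finset.prod_const, Finset.card_univ,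
        Fintype.card_fin, div_eq_inv_mul]
    simp_rw [h1]
    rw [integral_const_mul, integral_finsetSum]
    · simp_rw [h.rowExchangeable.integral_blocks hA hG hGs]
      rw [Finset.sum_const, Fintype.card_piFinset]
      simp only [Finset.card_range, Finset.prod_const, Finset.card_univ, Fintype.card_fin,
        nsmul_eq_mul, Nat.cast_pow]
      have : (K : ℝ) ^ M ≠ 0 := by positivity
      rw [inv_mul_cancel_left₀ this]
    · intro k _
      refine Integrable.of_bound ((Finset.measurable_fun_prod _ fun m _ =>
        hXm m (k m)).mul hGm).aestronglyMeasurable 1 (ae_of_all _ fun ω => ?_)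
      rw [norm_mul]
      refine mul_le_one₀ ?_ (norm_nonneg _) (hGb ω)
      rw [norm_prod]
      refine Finset.prod_le_one (fun _ _ => norm_nonneg _) fun m _ => ?_
      exact (norm_indicator_le_norm_self _ _).trans (by simp)
  have hlim : Tendsto (fun K : ℕ => ∫ ω, (∏ m : Fin M, blockFreq (A m) K (fun n => ξ m n ω))
      * ∏ m, G m (fun n => ξ m n ω) ∂P) atTop
      (𝓝 (∫ ω, (∏ m : Fin M, (Measure.pi fun _ : Fin N => (μ m ω : Measure S)).real (A m))
        * ∏ m, G m (fun n => ξ m n ω) ∂P)) := by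
    refine tendsto_integral_of_dominated_convergence (fun _ => 1) (fun K => ?_)
      (integrable_const _) (fun K => ae_of_all _ fun ω => ?_) ?_
    · exact ((Finset.measurable_fun_prod _ fun m _ =>
        (measurable_blockFreq (hA m) K).comp (hrow m)).mul hGm).aestronglyMeasurable
    · rw [norm_mul]
      refine mul_le_one₀ ?_ (norm_nonneg _) (hGb ω)
      rw [norm_prod]
      refine Finset.prod_le_one (fun _ _ => norm_nonneg _) fun m _ => ?_
      rw [Real.norm_of_nonneg (blockFreq_nonneg _ _ _)]
      exact blockFreq_le_one _ _ _
    · have := ae_all_iff.2 fun m : Fin M => (h.entries m).tendsto_blockFreq (hA m)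
      filter_upwards [this] with ω hω
      exact (tendsto_finsetProd _ fun m _ => hω m).mul_const _
  refine tendsto_nhds_unique (tendsto_const_nhds.congr' ?_) hlim
  filter_upwards [eventually_gt_atTop 0] with K hK
  exact (hconst K hK).symm

/-- Given the row distributions, the rows are independent samples. -/
theorem IsNDPArray.restrict_obs_map (h : IsNDPArray κ ε ϱ ϖ μ ξ P)
    {M N : ℕ} {A : Fin M → Set (Fin N → S)} (hA : ∀ m, MeasurableSet (A m)) :
    (P.restrict {ω | ∀ m : Fin M, rowData ξ N m ω ∈ A m}).map (fun ω (m : Fin M) => μ m ω)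
      = (P.withDensity fun ω => ∏ m : Fin M,
          (Measure.pi fun _ : Fin N => (μ m ω : Measure S)) (A m)).map
          fun ω (m : Fin M) => μ m ω := by
  classical
  have hμ := measurable_rows h.rows
  have hμM : Measurable fun ω (m : Fin M) => μ m ω := measurable_pi_lambda _ fun m => hμ m
  have hobs : MeasurableSet {ω | ∀ m : Fin M, rowData ξ N m ω ∈ A m} := by
    rw [Set.ofPred_forall]
    exact MeasurableSet.iInter fun m => measurable_rowData h.entries N m (hA m)
  have hw : Measurable fun ω => ∏ m : Fin M,
      (Measure.pi fun _ : Fin N => (μ m ω : Measure S)) (A m) :=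
    Finset.measurable_fun_prod _ fun m _ => (measurable_pi_apply_set (hA m)).comp (hμ m)
  have key : ∀ s ∈ Set.univ.pi '' Set.univ.pi fun _ : Fin M => cylinders S,
      (P.restrict {ω | ∀ m : Fin M, rowData ξ N m ω ∈ A m}).map (fun ω (m : Fin M) => μ m ω) s
        = (P.withDensity fun ω => ∏ m : Fin M,
          (Measure.pi fun _ : Fin N => (μ m ω : Measure S)) (A m)).map
          (fun ω (m : Fin M) => μ m ω) s := by
    rintro _ ⟨s, hs, rfl⟩
    choose d p D hp hD hsD using fun m => hs m (Set.mem_univ m)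
    have hsm : ∀ m, MeasurableSet (s m) := fun m => hsD m ▸ measurable_cells (hp m) (hD m)
    have hbox := MeasurableSet.univ_pi hsm
    -- The indicator of a cylinder event for μ m, rewritten almost surely as a function of row m
    -- that block swaps leave invariant.
    let G : Fin M → (ℕ → S) → ℝ := fun m x => (D m).indicator 1 (cellFreq (p m) x)
    have hGae : ∀ᵐ ω ∂P, ∀ m : Fin M, G m (fun n => ξ m n ω) = (s m).indicator 1 (μ m ω) := by
      refine ae_all_iff.2 fun m => ?_
      filter_upwards [(h.entries m).cellFreq_eq (hp m)] with ω hω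
      simp only [G, hω, hsD m]
      rfl
    have h1 := h.integral_obs hA (G := G)
      (fun m => (measurable_one.indicator (hD m)).comp (measurable_cellFreq (hp m)))
      (fun m x => (norm_indicator_le_norm_self _ _).trans (by simp))
      (fun m c hc x => by simp only [G, cellFreq_comp_blockSwap])
    have hprod : ∀ᵐ ω ∂P, ∏ m : Fin M, G m (fun n => ξ m n ω)
        = (Set.univ.pi s).indicator 1 fun m : Fin M => μ m ω := by
      filter_upwards [hGae] with ω hω
      simp_rw [hω]
      simp only [Set.indicator_apply, Pi.one_apply, Finset.prod_ite_zero, Finset.prod_const_one,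
        Set.mem_univ_pi, Finset.mem_univ, true_implies]
    have hL : ∫ ω, (∏ m, (A m).indicator (1 : (Fin N → S) → ℝ) (rowData ξ N m ω))
        * ∏ m : Fin M, G m (fun n => ξ m n ω) ∂P
        = P.real ({ω | ∀ m : Fin M, rowData ξ N m ω ∈ A m} ∩
          (fun ω (m : Fin M) => μ m ω) ⁻¹' Set.univ.pi s) := by
      rw [← integral_indicator_one (hobs.inter (hμM hbox))]
      refine integral_congr_ae ?_
      filter_upwards [hprod] with ω hω
      rw [hω]
      simp only [Set.indicator_apply, Pi.one_apply, Finset.prod_ite_zero, Finset.prod_const_one,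
        Finset.mem_univ, true_implies, Set.mem_inter_iff, Set.mem_ofPred_eq, Set.mem_preimage]
      split_ifs <;> simp_all
    have hR : ∫ ω, (∏ m : Fin M, (Measure.pi fun _ : Fin N => (μ m ω : Measure S)).real (A m))
        * ∏ m : Fin M, G m (fun n => ξ m n ω) ∂P
        = (∫⁻ ω in (fun ω (m : Fin M) => μ m ω) ⁻¹' Set.univ.pi s, ∏ m : Fin M,
          (Measure.pi fun _ : Fin N => (μ m ω : Measure S)) (A m) ∂P).toReal := by
      rw [← integral_toReal hw.aemeasurable (ae_of_all _ fun ω =>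
        ENNReal.prod_lt_top fun m _ => measure_lt_top _ _), ← integral_indicator (hμM hbox)]
      refine integral_congr_ae ?_
      filter_upwards [hprod] with ω hω
      rw [hω, Set.indicator_apply, Set.indicator_apply, ENNReal.toReal_prod]
      simp only [Set.mem_preimage, Pi.one_apply, mul_ite, mul_one, mul_zero]
      rfl
    rw [Measure.map_apply hμM hbox, Measure.map_apply hμM hbox,
      Measure.restrict_apply (hμM hbox), withDensity_apply _ (hμM hbox), Set.inter_comm]
    rw [hL, hR, measureReal_def] at h1
    refine (ENNReal.toReal_eq_toReal_iff' (measure_ne_top _ _) ?_).1 h1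
    refine ((setLIntegral_mono measurable_const fun ω _ =>
      Finset.prod_le_one' fun m _ => prob_le_one).trans_lt ?_).ne
    simp
  have huniv : Set.univ ∈ Set.univ.pi '' Set.univ.pi fun _ : Fin M => cylinders S :=
    ⟨fun _ => Set.univ, fun _ _ => univ_mem_cylinders, by simp⟩
  refine ext_of_generate_finite _ (generateFrom_eq_pi (fun _ => generateFrom_cylinders.symm)
    fun _ => ⟨fun _ => Set.univ, fun _ => univ_mem_cylinders, Set.iUnion_const _⟩).symm
    (IsPiSystem.pi fun _ => isPiSystem_cylinders) key (key _ huniv)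

/-- The unnormalised posterior is likelihood times prior. The right side is the one of
`IsSimulation.lintegral_totalWeight_mul`, which ties the simulation to the conditional law. -/
theorem IsNDPArray.lintegral_obs (h : IsNDPArray κ ε ϱ ϖ μ ξ P)
    {M N : ℕ} {A : Fin M → Set (Fin N → S)} (hA : ∀ m, MeasurableSet (A m))
    {g : (Fin M → ProbabilityMeasure S) → ℝ≥0∞} (hg : Measurable g) :
    ∫⁻ ω in {ω | ∀ m : Fin M, rowData ξ N m ω ∈ A m}, g (fun m => μ m ω) ∂P
      = ∫⁻ v, (∏ m, (Measure.pi fun _ : Fin N => (v m : Measure S)) (A m)) * g v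
          ∂sampleLaw (dirichletLaw (κ • dirichletLaw (ε • (ϱ : Measure S)))) M := by
  have hμ := measurable_rows h.rows
  have hμM : Measurable fun ω (m : Fin M) => μ m ω := measurable_pi_lambda _ fun m => hμ m
  have hw : Measurable fun v : Fin M → ProbabilityMeasure S => ∏ m : Fin M,
      (Measure.pi fun _ : Fin N => (v m : Measure S)) (A m) :=
    Finset.measurable_fun_prod _ fun m _ =>
      (measurable_pi_apply_set (hA m)).comp (measurable_pi_apply m)
  have hwg : Measurable fun v : Fin M → ProbabilityMeasure S => (∏ m : Fin M,
      (Measure.pi fun _ : Fin N => (v m : Measure S)) (A m)) * g v := hw.mul hg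
  have h1 := lintegral_withDensity_eq_lintegral_mul P (hw.comp hμM) (hg.comp hμM)
  simp only [Function.comp_def, Pi.mul_apply] at h1
  rw [← lintegral_rows h.rows h.generator Fin.val_injective hwg, ← lintegral_map hg hμM,
    h.restrict_obs_map hA, lintegral_map hg hμM]
  exact h1

end Array

/-! ### A countable class of open sets that controls all open sets -/

section Topology

/-- The finite unions of sets of a countable topological basis. -/
def finiteUnions (X : Type*) [TopologicalSpace X] [SecondCountableTopology X] : Set (Set X) :=
  Set.sUnion '' {F : Set (Set X) | F.Finite ∧ F ⊆ TopologicalSpace.countableBasis X}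

variable {X : Type*} [TopologicalSpace X] [SecondCountableTopology X]

theorem countable_finiteUnions : (finiteUnions X).Countable :=
  (Set.countable_ofPred_finite_subset (TopologicalSpace.countable_countableBasis X)).image _

theorem isOpen_of_mem_finiteUnions {U : Set X} (hU : U ∈ finiteUnions X) : IsOpen U := by
  obtain ⟨F, ⟨-, hF⟩, rfl⟩ := hU
  exact isOpen_sUnion fun B hB => TopologicalSpace.isOpen_of_mem_countableBasis (hF hB)

/-- Finite unions are taken so that the members inside G form a directed family; continuity from
below along this countable family gives the supremum. -/
theorem measure_isOpen_eq_iSup [MeasurableSpace X] (Q : Measure X) {G : Set X} (hG : IsOpen G) :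
    Q G = ⨆ U ∈ {U ∈ finiteUnions X | U ⊆ G}, Q U := by
  have hGU : G = ⋃ U ∈ {U ∈ finiteUnions X | U ⊆ G}, id U := by
    refine subset_antisymm (fun x hx => ?_) (Set.iUnion₂_subset fun U hU => hU.2)
    obtain ⟨B, hB, hxB, hBG⟩ :=
      (TopologicalSpace.isBasis_countableBasis X).exists_subset_of_mem_open hx hG
    refine Set.mem_biUnion (x := B) ⟨⟨{B}, ⟨Set.finite_singleton B, ?_⟩, Set.sUnion_singleton B⟩,
      hBG⟩ hxB
    simpa using hB
  conv_lhs => rw [hGU]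
  refine measure_biUnion_eq_iSup (countable_finiteUnions.mono (Set.sep_subset _ _)) ?_
  rintro _ ⟨⟨F, ⟨hF, hFb⟩, rfl⟩, hFG⟩ _ ⟨⟨F', ⟨hF', hFb'⟩, rfl⟩, hFG'⟩
  refine ⟨⋃₀ (F ∪ F'), ⟨⟨F ∪ F', ⟨hF.union hF', Set.union_subset hFb hFb'⟩, rfl⟩, ?_⟩,
    Set.sUnion_subset_sUnion Set.subset_union_left,
    Set.sUnion_subset_sUnion Set.subset_union_right⟩
  rw [Set.sUnion_union]
  exact Set.union_subset hFG hFG'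

theorem measure_isOpen_le_liminf [MeasurableSpace X] {ι : Type*} {L : Filter ι}
    {Q : ι → Measure X} {Q₀ : Measure X}
    (h : ∀ U ∈ finiteUnions X, Q₀ U ≤ liminf (fun i => Q i U) L) {G : Set X} (hG : IsOpen G) :
    Q₀ G ≤ liminf (fun i => Q i G) L := by
  rw [measure_isOpen_eq_iSup Q₀ hG]
  refine iSup₂_le fun U hU => (h U hU.1).trans ?_
  exact liminf_le_liminf (Eventually.of_forall fun i => measure_mono hU.2)

end Topology

/-! ### The weak topology and the evaluation σ-algebra -/

section ProbabilityMeasure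

variable {S : Type*} [TopologicalSpace S] [SecondCountableTopology S] [MeasurableSpace S]
  [OpensMeasurableSpace S] [HasOuterApproxClosed S]

/-- Both inclusions are portmanteau: ν ↦ ν(U) is lower semicontinuous for open U, and lower
semicontinuity on the finite unions alone already forces weak convergence. The subbasis is countable
and consists of sets measurable for the evaluations. -/
theorem topology_probabilityMeasure_eq_generateFrom :
    (inferInstance : TopologicalSpace (ProbabilityMeasure S)) = TopologicalSpace.generateFrom
      (⋃ U ∈ finiteUnions S, Set.range fun q : ℚ =>
        {ν : ProbabilityMeasure S | (Real.toNNReal q : ℝ≥0∞) < (ν : Measure S) U}) := by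
  set 𝓑 : Set (Set (ProbabilityMeasure S)) := ⋃ U ∈ finiteUnions S, Set.range fun q : ℚ =>
        {ν : ProbabilityMeasure S | (Real.toNNReal q : ℝ≥0∞) < (ν : Measure S) U} with h𝓑
  have hc : 𝓑.Countable := countable_finiteUnions.biUnion fun U _ => Set.countable_range _
  refine le_antisymm (le_generateFrom fun s hs => ?_) ?_
  · simp only [h𝓑, Set.mem_iUnion, Set.mem_range] at hs
    obtain ⟨U, hU, q, rfl⟩ := hs
    refine isOpen_iff_mem_nhds.2 fun ν hν => ?_
    have h1 := ProbabilityMeasure.le_liminf_measure_open_of_tendsto (L := 𝓝 ν) tendsto_id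
      (isOpen_of_mem_finiteUnions hU)
    exact eventually_lt_of_lt_liminf (lt_of_lt_of_le hν h1)
  · refine le_of_nhds_le_nhds fun ν => ?_
    -- The converse half of portmanteau is used along this neighbourhood filter, which a countable
    -- subbasis makes countably generated.
    have : (@nhds _ (TopologicalSpace.generateFrom 𝓑) ν).IsCountablyGenerated := by
      let :=  TopologicalSpace.generateFrom 𝓑
      have : SecondCountableTopology (ProbabilityMeasure S) := ⟨𝓑, hc, rfl⟩
      infer_instance
    refine tendsto_of_forall_isOpen_le_liminf' (μs := id) fun G hG => ?_
    refine measure_isOpen_le_liminf (fun U hU => ?_) hG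
    refine le_of_forall_lt fun c hc => ?_
    obtain ⟨q, -, hcq, hq⟩ := ENNReal.lt_iff_exists_rat_btwn.1 hc
    refine hcq.trans_le (le_liminf_of_le (by isBoundedDefault) ?_)
    have hmem : {ν : ProbabilityMeasure S | (Real.toNNReal q : ℝ≥0∞) < (ν : Measure S) U} ∈ 𝓑 :=
      Set.mem_biUnion hU ⟨q, rfl⟩
    have := @IsOpen.mem_nhds _ (TopologicalSpace.generateFrom 𝓑) ν _
      (TopologicalSpace.isOpen_generateFrom_of_mem hmem) hq
    filter_upwards [this] with ν' hν'
    exact le_of_lt hν'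

instance secondCountableTopology_probabilityMeasure :
    SecondCountableTopology (ProbabilityMeasure S) :=
  ⟨_, countable_finiteUnions.biUnion fun _ _ => Set.countable_range _,
    topology_probabilityMeasure_eq_generateFrom⟩

instance opensMeasurableSpace_probabilityMeasure :
    OpensMeasurableSpace (ProbabilityMeasure S) := by
  refine ⟨?_⟩
  rw [borel_eq_generateFrom_of_subbasis topology_probabilityMeasure_eq_generateFrom]
  refine MeasurableSpace.generateFrom_le fun s hs => ?_
  simp only [Set.mem_iUnion, Set.mem_range] at hs
  obtain ⟨U, hU, q, rfl⟩ := hs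
  exact measurableSet_lt measurable_const
    ((Measure.measurable_coe (isOpen_of_mem_finiteUnions hU).measurableSet).comp
      measurable_subtype_coe)

end ProbabilityMeasure

/-! ### Test functions that are continuous almost everywhere -/

section Portmanteau

variable {X : Type*} [TopologicalSpace X] [SecondCountableTopology X] [MeasurableSpace X]

/-- Push everything forward to ℝ by f. At continuity points the preimage of an open set agrees with
its interior, so the image laws satisfy the open-set criterion and converge weakly. -/
theorem tendsto_integral_of_ae_continuousAt {Q : ℕ → Measure X} {Q₀ : Measure X}
    [∀ K, IsProbabilityMeasure (Q K)] [IsProbabilityMeasure Q₀]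
    (h : ∀ U ∈ finiteUnions X, Tendsto (fun K => Q K U) atTop (𝓝 (Q₀ U)))
    {f : X → ℝ} (hf : Measurable f) {c : ℝ} (hc : ∀ x, |f x| ≤ c)
    (hcont : ∀ᵐ x ∂Q₀, ContinuousAt f x) :
    Tendsto (fun K => ∫ x, f x ∂Q K) atTop (𝓝 (∫ x, f x ∂Q₀)) := by
  have hmap : ∀ R : Measure X, IsProbabilityMeasure R → IsProbabilityMeasure (R.map f) :=
    fun R hR => Measure.isProbabilityMeasure_map hf.aemeasurable
  let R : ℕ → ProbabilityMeasure ℝ := fun K => ⟨(Q K).map f, hmap _ inferInstance⟩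
  let R₀ : ProbabilityMeasure ℝ := ⟨Q₀.map f, hmap _ inferInstance⟩
  have hlim : Tendsto R atTop (𝓝 R₀) := by
    refine tendsto_of_forall_isOpen_le_liminf' fun G hG => ?_
    change (Q₀.map f) G ≤ liminf (fun K => ((Q K).map f) G) atTop
    simp only [Measure.map_apply hf hG.measurableSet]
    calc Q₀ (f ⁻¹' G) ≤ Q₀ (interior (f ⁻¹' G)) := by
          refine measure_mono_ae ?_
          filter_upwards [hcont] with x hx hxG
          exact mem_interior_iff_mem_nhds.2 (hx (hG.mem_nhds hxG))
      _ ≤ liminf (fun K => Q K (interior (f ⁻¹' G))) atTop :=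
          measure_isOpen_le_liminf (fun U hU => (h U hU).liminf_eq.ge) isOpen_interior
      _ ≤ _ := liminf_le_liminf (Eventually.of_forall fun K => measure_mono interior_subset)
  -- Clamping to [-c, c] gives a bounded continuous stand-in for the identity that fixes all values
  -- of f.
  let g : ℝ →ᵇ ℝ := BoundedContinuousFunction.ofNormedAddCommGroup (fun x => max (-c) (min x c))
    (by fun_prop) |c| (fun x => by
      rw [Real.norm_eq_abs]
      refine abs_le.2 ⟨?_, ?_⟩
      · exact (neg_le_neg (le_abs_self c)).trans (le_max_left _ _)
      · exact max_le (neg_le_abs c) ((min_le_right _ _).trans (le_abs_self c)))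
  have hg : ∀ x, g (f x) = f x := fun x => by
    obtain ⟨h1, h2⟩ := abs_le.1 (hc x)
    change max (-c) (min (f x) c) = f x
    rw [min_eq_left h2, max_eq_right h1]
  have h1 := (ProbabilityMeasure.tendsto_iff_forall_integral_tendsto.1 hlim) g
  have h2 : ∀ ν : Measure X, ∫ y, g y ∂(ν.map f) = ∫ x, f x ∂ν := fun ν => by
    rw [integral_map hf.aemeasurable g.continuous.aestronglyMeasurable]
    simp only [hg]
  change Tendsto (fun K => ∫ y, g y ∂((Q K).map f)) atTop (𝓝 (∫ y, g y ∂(Q₀.map f))) at h1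
  simpa only [h2] using h1

end Portmanteau

/-! ### Weighted empirical measures as ratios of means -/

section WeightedEmpirical

variable {E : Type*} [MeasurableSpace E]

theorem weightedEmpirical_apply (V : ℕ → ℝ≥0) (z : ℕ → E) (K : ℕ) {B : Set E}
    (hB : MeasurableSet B) :
    weightedEmpirical V z K B
      = ((∑ k ∈ Finset.range K, V k)⁻¹ : ℝ≥0)
        * ∑ k ∈ Finset.range K, V k * B.indicator (1 : E → ℝ≥0∞) (z k) := by
  rw [weightedEmpirical, Measure.smul_apply, Measure.finsetSum_apply]
  simp only [Measure.smul_apply, Measure.dirac_apply' _ hB]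
  rfl

theorem isProbabilityMeasure_weightedEmpirical {V : ℕ → ℝ≥0} (hV : ∀ k, 0 < V k) (z : ℕ → E)
    (K : ℕ) : IsProbabilityMeasure (weightedEmpirical V z (K + 1)) := by
  refine ⟨?_⟩
  have : ∑ k ∈ Finset.range (K + 1), V k ≠ 0 :=
    (Finset.sum_pos (fun k _ => hV k) (by simp)).ne'
  rw [weightedEmpirical_apply _ _ _ MeasurableSet.univ]
  simp only [Set.indicator_univ, Pi.one_apply, mul_one]
  rw [← ENNReal.ofNNReal_finsetSum, ← ENNReal.coe_mul, inv_mul_cancel₀ this, ENNReal.coe_one]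

theorem map_weightedEmpirical {F : Type*} [MeasurableSpace F] (V : ℕ → ℝ≥0) (z : ℕ → E) (K : ℕ)
    {Φ : E → F} (hΦ : Measurable Φ) :
    (weightedEmpirical V z K).map Φ = weightedEmpirical V (fun k => Φ (z k)) K := by
  ext B hB
  rw [Measure.map_apply hΦ hB, weightedEmpirical_apply _ _ _ hB,
    weightedEmpirical_apply _ _ _ (hΦ hB)]
  rfl

theorem tendsto_weightedEmpirical {V : ℕ → ℝ≥0} {z : ℕ → E} {B : Set E} (hB : MeasurableSet B)
    {a b : ℝ} (hb : b ≠ 0)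
    (h1 : Tendsto (fun K : ℕ => (∑ k ∈ Finset.range K, (V k : ℝ) * B.indicator 1 (z k)) / K) atTop
      (𝓝 a))
    (h2 : Tendsto (fun K : ℕ => (∑ k ∈ Finset.range K, (V k : ℝ)) / K) atTop (𝓝 b)) :
    Tendsto (fun K => weightedEmpirical V z K B) atTop (𝓝 (ENNReal.ofReal (a / b))) := by
  refine (ENNReal.tendsto_ofReal (h1.div h2 hb)).congr' ?_
  filter_upwards [eventually_gt_atTop 0] with K hK
  have hind : ∀ k, B.indicator (1 : E → ℝ≥0∞) (z k)
      = ((B.indicator (1 : E → ℝ≥0) (z k) : ℝ≥0) : ℝ≥0∞) := fun k => by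
    by_cases h : z k ∈ B <;> simp [h]
  have hind' : ∀ k, B.indicator (1 : E → ℝ) (z k)
      = ((B.indicator (1 : E → ℝ≥0) (z k) : ℝ≥0) : ℝ) := fun k => by
    by_cases h : z k ∈ B <;> simp [h]
  have hK' : (K : ℝ) ≠ 0 := by exact_mod_cast hK.ne'
  rw [weightedEmpirical_apply _ _ _ hB]
  simp only [hind, hind', Pi.div_apply]
  rw [div_div_div_cancel_right₀ hK', ← ENNReal.ofReal_coe_nnreal (p := _⁻¹)]
  simp_rw [← ENNReal.coe_mul]
  rw [← ENNReal.ofNNReal_finsetSum, ENNReal.ofReal_coe_nnreal, ← ENNReal.coe_mul,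
    ← ENNReal.ofReal_coe_nnreal]
  congr 1
  push_cast
  rw [div_eq_inv_mul]

end WeightedEmpirical

/-! ### The strong law for weighted simulations -/

section LargeNumbers

variable {S : Type*} [MeasurableSpace S] {κ ε : ℝ≥0} {ϱ : ProbabilityMeasure S}
  {M N : ℕ} {ϱN : Measure (Fin N → S)} {A : Fin M → Set (Fin N → S)}
  {Ω' : Type*} [MeasurableSpace Ω'] {P' : Measure Ω'}

theorem IsSimulation.measurable {u : Ω' → Fin M → ProbabilityMeasure S}
    (hu : IsSimulation κ ε ϱ ϱN A u P') : Measurable u :=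
  measurable_pi_lambda _ fun m => (hu m).measurable_left

/-- The importance sampling identity applied to V⁻¹ 1_B, legitimate as V > 0, expresses the law of a
simulation without reference to the simulation. This supplies the identical distribution needed for
the strong law. -/
theorem IsSimulation.map_eq [IsProbabilityMeasure P'] (hκ : 0 < κ)
    (h : IsDirichletLaw (ε • (ϱ : Measure S)) (dirichletLaw (ε • (ϱ : Measure S))))
    (hβ : IsDirichletLaw (κ • dirichletLaw (ε • (ϱ : Measure S)))
      (dirichletLaw (κ • dirichletLaw (ε • (ϱ : Measure S)))))
    (hϱN : ϱN = sampleLaw (dirichletLaw (ε • (ϱ : Measure S))) N)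
    (hA : ∀ m, MeasurableSet (A m)) (hA0 : ∀ m, ϱN (A m) ≠ 0)
    {u u' : Ω' → Fin M → ProbabilityMeasure S}
    (hu : IsSimulation κ ε ϱ ϱN A u P') (hu' : IsSimulation κ ε ϱ ϱN A u' P') :
    P'.map u = P'.map u' := by
  have hfin : IsFiniteMeasure ϱN := by
    have := h.isProbabilityMeasure
    have := isProbabilityMeasure_sampleLaw (dirichletLaw (ε • (ϱ : Measure S))) N
    rw [hϱN]
    infer_instance
  ext B hB
  have hg : Measurable fun v : Fin M → ProbabilityMeasure S =>
      (totalWeight κ ϱN A v : ℝ≥0∞)⁻¹ * B.indicator 1 v :=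
    (measurable_totalWeight ϱN hA).coe_nnreal_ennreal.inv.mul (measurable_one.indicator hB)
  have key : ∀ w : Ω' → Fin M → ProbabilityMeasure S, IsSimulation κ ε ϱ ϱN A w P' →
      P'.map w B = ∫⁻ ω, totalWeight κ ϱN A (w ω)
        * ((totalWeight κ ϱN A (w ω) : ℝ≥0∞)⁻¹ * B.indicator 1 (w ω)) ∂P' := fun w hw => by
    rw [← lintegral_indicator_one hB, lintegral_map (measurable_one.indicator hB) hw.measurable]
    refine lintegral_congr fun ω => ?_
    rw [← mul_assoc, ENNReal.mul_inv_cancel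
      (by exact_mod_cast (totalWeight_pos hκ hA0 (w ω)).ne') ENNReal.coe_ne_top, one_mul]
  rw [key u hu, key u' hu', hu.lintegral_totalWeight_mul h hβ hϱN hA hg,
    hu'.lintegral_totalWeight_mul h hβ hϱN hA hg]

theorem ae_tendsto_mean_totalWeight [IsProbabilityMeasure P'] (hκ : 0 < κ)
    (h : IsDirichletLaw (ε • (ϱ : Measure S)) (dirichletLaw (ε • (ϱ : Measure S))))
    (hβ : IsDirichletLaw (κ • dirichletLaw (ε • (ϱ : Measure S)))
      (dirichletLaw (κ • dirichletLaw (ε • (ϱ : Measure S)))))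
    (hϱN : ϱN = sampleLaw (dirichletLaw (ε • (ϱ : Measure S))) N)
    (hA : ∀ m, MeasurableSet (A m)) (hA0 : ∀ m, ϱN (A m) ≠ 0)
    {u : ℕ → Ω' → Fin M → ProbabilityMeasure S}
    (hu : ∀ k, IsSimulation κ ε ϱ ϱN A (u k) P') (hindep : iIndepFun u P')
    {B : Set (Fin M → ProbabilityMeasure S)} (hB : MeasurableSet B) {c : ℝ≥0∞} (hc : c ≠ ∞)
    (hBc : ∫⁻ ω, totalWeight κ ϱN A (u 0 ω) * B.indicator 1 (u 0 ω) ∂P' = c) :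
    ∀ᵐ ω ∂P', Tendsto (fun K : ℕ => (∑ k ∈ Finset.range K,
      (totalWeight κ ϱN A (u k ω) : ℝ) * B.indicator 1 (u k ω)) / K) atTop (𝓝 c.toReal) := by
  let F : (Fin M → ProbabilityMeasure S) → ℝ := fun v => totalWeight κ ϱN A v * B.indicator 1 v
  have hF : Measurable F :=
    (measurable_totalWeight ϱN hA).coe_nnreal_real.mul (measurable_one.indicator hB)
  have hF0 : ∀ v, 0 ≤ F v := fun v =>
    mul_nonneg (NNReal.coe_nonneg _) (Set.indicator_nonneg (fun _ _ => zero_le_one) _)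
  have hFe : ∀ v, ENNReal.ofReal (F v) = totalWeight κ ϱN A v * B.indicator 1 v := fun v => by
    by_cases hv : v ∈ B <;> simp [F, hv]
  have hF0m : Measurable fun ω => F (u 0 ω) := hF.comp (hu 0).measurable
  have hlint : ∫⁻ ω, ENNReal.ofReal (F (u 0 ω)) ∂P' = c := by
    simp only [hFe]; exact hBc
  have hint : Integrable (fun ω => F (u 0 ω)) P' :=
    ⟨hF0m.aestronglyMeasurable, by
      rw [hasFiniteIntegral_iff_ofReal (ae_of_all _ fun ω => hF0 _), hlint]
      exact hc.lt_top⟩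
  have hE : ∫ ω, F (u 0 ω) ∂P' = c.toReal := by
    rw [integral_eq_lintegral_of_nonneg_ae (ae_of_all _ fun ω => hF0 _)
      hF0m.aestronglyMeasurable, hlint]
  have := strong_law_ae_real (fun k ω => F (u k ω)) hint
    (fun i j hij => (hindep.indepFun hij).comp hF hF)
    (fun k => (IdentDistrib.mk (hu k).measurable.aemeasurable (hu 0).measurable.aemeasurable
      (IsSimulation.map_eq hκ h hβ hϱN hA hA0 (hu k) (hu 0))).comp hF)
  rw [hE] at this
  exact this

end LargeNumbers

end NDP

/-! ### The convergence theorem -/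

theorem theorem4p1
    {S : Type*} [MetricSpace S] [CompleteSpace S] [TopologicalSpace.SeparableSpace S]
    [MeasurableSpace S] [BorelSpace S]
    {Ω : Type*} [MeasurableSpace Ω] (P : Measure Ω) [IsProbabilityMeasure P]
    (κ ε : ℝ≥0) (hκ : 0 < κ) (hε : 0 < ε) (ϱ : ProbabilityMeasure S)
    (ϖ : Ω → ProbabilityMeasure (ProbabilityMeasure S))
    (μ : ℕ → Ω → ProbabilityMeasure S) (ξ : ℕ → ℕ → Ω → S)
    (hξ : NDP.IsNDPArray κ ε ϱ ϖ μ ξ P)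
    -- the discrete observations `Y m = φ m (X_{mN})` and the observed value `y`
    {T : Type*} [Countable T] [MeasurableSpace T] [MeasurableSingletonClass T]
    (M N : ℕ) (φ : Fin M → (Fin N → S) → T) (hφ : ∀ m, Measurable (φ m))
    (Y : Ω → Fin M → T) (hY : ∀ ω m, Y ω m = φ m (NDP.rowData ξ N m ω))
    (y : Fin M → T) (hy : P (Y ⁻¹' {y}) ≠ 0)
    -- `ϱN` is the law of the first `N` entries of a row, and `A m` is the event `Y m = y m`
    (ϱN : Measure (Fin N → S)) (hϱN : ϱN = P.map (NDP.rowData ξ N 0))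
    (A : Fin M → Set (Fin N → S)) (hA : ∀ m, A m = φ m ⁻¹' {y m})
    -- an independent sequence of weighted simulations, with total weights `V k`
    {Ω' : Type*} [MeasurableSpace Ω'] (P' : Measure Ω') [IsProbabilityMeasure P']
    (u : ℕ → Ω' → Fin M → ProbabilityMeasure S)
    (hu : ∀ k, NDP.IsSimulation κ ε ϱ ϱN A (u k) P')
    (hindep : iIndepFun u P')
    (V : ℕ → Ω' → ℝ≥0) (hV : ∀ k ω', V k ω' = NDP.totalWeight κ ϱN A (u k ω')) :
    (∀ᵐ ω' ∂P', NDP.WeaklyTendsto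
      (NDP.weightedEmpirical (fun k => V k ω') (fun k => u k ω'))
      ((ProbabilityTheory.cond P (Y ⁻¹' {y})).map fun ω (m : Fin M) => μ m ω)) ∧
    (∀ (E : Type*) [MetricSpace E] [MeasurableSpace E] [BorelSpace E]
      (Φ : (Fin M → ProbabilityMeasure S) → E), Measurable Φ →
      (∀ᵐ ω ∂(ProbabilityTheory.cond P (Y ⁻¹' {y})), ContinuousAt Φ fun m : Fin M => μ m ω) →
      ∀ᵐ ω' ∂P', NDP.WeaklyTendsto
        (NDP.weightedEmpirical (fun k => V k ω') (fun k => Φ (u k ω')))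
        ((ProbabilityTheory.cond P (Y ⁻¹' {y})).map fun ω => Φ fun m : Fin M => μ m ω)) := by
  have : SecondCountableTopology S := UniformSpace.secondCountable_of_separable S
  have hAm : ∀ m, MeasurableSet (A m) := fun m => hA m ▸ hφ m (measurableSet_singleton _)
  have hobs : Y ⁻¹' {y} = {ω | ∀ m : Fin M, NDP.rowData ξ N m ω ∈ A m} := by
    ext ω
    simp only [Set.mem_preimage, Set.mem_singleton_iff, Set.mem_ofPred_eq, hA, ← hY, funext_iff]
  have hrow := NDP.measurable_rowData hξ.entries N
  have hobsm : MeasurableSet (Y ⁻¹' {y}) := by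
    rw [hobs, Set.ofPred_forall]
    exact MeasurableSet.iInter fun m => hrow m (hAm m)
  have hbase := NDP.isDirichletLaw_base hξ.generator
  have hgen := NDP.isDirichletLaw_generator hξ.generator
  have hmap := NDP.map_rowData hκ hξ.rows hξ.entries hξ.generator N
  have hϱN' : ϱN = NDP.sampleLaw (NDP.dirichletLaw (ε • (ϱ : Measure S))) N := hϱN.trans (hmap 0)
  have : IsProbabilityMeasure ϱN :=
    hϱN ▸ Measure.isProbabilityMeasure_map (hrow 0).aemeasurable
  -- The event Y = y forces row m into A m, and all rows have the same law, so a null A m would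
  -- contradict P(Y = y) > 0.
  have hA0 : ∀ m, ϱN (A m) ≠ 0 := fun m h0 => hy <| by
    rw [hϱN', ← hmap m, Measure.map_apply (hrow m) (hAm m)] at h0
    refine measure_mono_null (fun ω hω => ?_) h0
    rw [hobs] at hω
    exact hω m
  have hμM : Measurable fun ω (m : Fin M) => μ m ω :=
    measurable_pi_lambda _ fun m => NDP.measurable_rows hξ.rows m
  have hVpos : ∀ k ω', 0 < V k ω' := fun k ω' => hV k ω' ▸ NDP.totalWeight_pos hκ hA0 _
  have : IsProbabilityMeasure (ProbabilityTheory.cond P (Y ⁻¹' {y})) :=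
    cond_isProbabilityMeasure hy
  set Q := (ProbabilityTheory.cond P (Y ⁻¹' {y})).map fun ω (m : Fin M) => μ m ω with hQ
  have : IsProbabilityMeasure Q := Measure.isProbabilityMeasure_map hμM.aemeasurable
  -- The two identities meet here: the mean of V 1_B(u) is P(Y = y, μ ∈ B).
  have hmean : ∀ B : Set (Fin M → ProbabilityMeasure S), MeasurableSet B →
      ∀ᵐ ω' ∂P', Tendsto (fun K : ℕ => (∑ k ∈ Finset.range K, (V k ω' : ℝ)
        * B.indicator 1 (u k ω')) / K) atTop
        (𝓝 (P.real (Y ⁻¹' {y} ∩ (fun ω (m : Fin M) => μ m ω) ⁻¹' B))) := fun B hB => by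
    simp only [hV]
    refine NDP.ae_tendsto_mean_totalWeight hκ hbase hgen hϱN' hAm hA0 hu hindep hB
      (measure_ne_top _ _) ?_
    rw [(hu 0).lintegral_totalWeight_mul hbase hgen hϱN' hAm (measurable_one.indicator hB),
      ← hξ.lintegral_obs hAm (measurable_one.indicator hB), ← hobs, Set.inter_comm,
      ← Measure.restrict_apply (hμM hB), ← lintegral_indicator_one (hμM hB)]
    rfl
  have hQB : ∀ B : Set (Fin M → ProbabilityMeasure S), MeasurableSet B →
      Q B = ENNReal.ofReal (P.real (Y ⁻¹' {y} ∩ (fun ω (m : Fin M) => μ m ω) ⁻¹' B)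
        / P.real (Y ⁻¹' {y})) := fun B hB => by
    have hpos : 0 < P.real (Y ⁻¹' {y}) := ENNReal.toReal_pos hy (measure_ne_top _ _)
    rw [hQ, Measure.map_apply hμM hB, cond_apply hobsm, ENNReal.ofReal_div_of_pos hpos,
      ofReal_measureReal, ofReal_measureReal, ENNReal.div_eq_inv_mul]
  have hfreq : ∀ᵐ ω' ∂P', ∀ U ∈ NDP.finiteUnions (Fin M → ProbabilityMeasure S),
      Tendsto (fun K => NDP.weightedEmpirical (fun k => V k ω') (fun k => u k ω') K U) atTop
        (𝓝 (Q U)) := by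
    rw [ae_ball_iff NDP.countable_finiteUnions]
    intro U hU
    have hUm := (NDP.isOpen_of_mem_finiteUnions hU).measurableSet
    filter_upwards [hmean U hUm, hmean Set.univ MeasurableSet.univ] with ω' h1 h2
    rw [hQB U hUm]
    refine NDP.tendsto_weightedEmpirical hUm
      (ENNReal.toReal_pos hy (measure_ne_top _ _)).ne' h1 ?_
    simpa using h2
  -- The exceptional null set comes from the countable class of open sets and is chosen before f.
  have hlim : ∀ᵐ ω' ∂P', ∀ (f : (Fin M → ProbabilityMeasure S) → ℝ) (c : ℝ), Measurable f →
      (∀ v, |f v| ≤ c) → (∀ᵐ v ∂Q, ContinuousAt f v) →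
      Tendsto (fun K => ∫ v, f v ∂(NDP.weightedEmpirical (fun k => V k ω') (fun k => u k ω') K))
        atTop (𝓝 (∫ v, f v ∂Q)) := by
    filter_upwards [hfreq] with ω' hω' f c hf hc hcont
    -- For K = 0 the weighted empirical measure is zero, so the sequence is shifted to consist of
    -- probability measures.
    rw [← tendsto_add_atTop_iff_nat 1]
    have := NDP.isProbabilityMeasure_weightedEmpirical (fun k => hVpos k ω') fun k => u k ω'
    exact NDP.tendsto_integral_of_ae_continuousAt
      (fun U hU => (tendsto_add_atTop_iff_nat 1).2 (hω' U hU)) hf hc hcont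
  refine ⟨?_, fun E _ _ _ Φ hΦ hcont => ?_⟩
  · filter_upwards [hlim] with ω' hω' f
    exact hω' f ‖f‖ f.continuous.measurable (fun v => f.norm_coe_le_norm v)
      (ae_of_all _ fun v => f.continuous.continuousAt)
  · filter_upwards [hlim] with ω' hω' f
    -- Strong measurability comes from the real codomain, because E need not be separable.
    have hfm : StronglyMeasurable f := f.continuous.measurable.stronglyMeasurable
    have hcont' : ∀ᵐ v ∂Q, ContinuousAt (fun v => f (Φ v)) v := by
      -- The continuity points of a real function form a Gδ set, hence a measurable one, so the
      -- condition can be pulled back to Ω.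
      rw [hQ, ae_map_iff hμM.aemeasurable (IsGδ.setOfPred_continuousAt _).measurableSet]
      filter_upwards [hcont] with ω hω
      exact f.continuous.continuousAt.comp hω
    have h1 := hω' (fun v => f (Φ v)) ‖f‖ (f.continuous.measurable.comp hΦ)
      (fun v => f.norm_coe_le_norm _) hcont'
    have h2 : ∀ ν : Measure (Fin M → ProbabilityMeasure S),
        ∫ v, f (Φ v) ∂ν = ∫ x, f x ∂(ν.map Φ) := fun ν =>
      (integral_map hΦ.aemeasurable hfm.aestronglyMeasurable).symm
    simp only [h2, NDP.map_weightedEmpirical _ _ _ hΦ] at h1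
    rwa [hQ, Measure.map_map hΦ hμM] at h1
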